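/- **Model.** Let $(\mathsf X_n,\mathcal X_n)_{n\in\mathbb N}$ be measurable spaces with $\sigma$-finite reference measures $\mu_n$ (write $dx_n$ for $\mu_n(dx_n)$), let $\chi:\mathsf X_0\to[0,\infty)$ and $\ell_n:\mathsf X_n\times\mathsf X_{n+1}\to[0,\infty)$ be measurable with $\sup_{x}\int \ell_n(x,x')\,dx'<\infty$, and assume that for every $n$ the function $x_{0:n}\mapsto\chi(x_0)\prod_{m=0}^{n-1}\ell_m(x_m,x_{m+1})$ has integral in $(0,\infty)$ with respect to $\mu_0\otimes\cdots\otimes\mu_n$. Let $\phi_{0:n}$ be the probability measure on $\mathsf X_0\times\cdots\times\mathsf X_n$ whose density with respect to $\mu_0\otimes\cdots\otimes\mu_n$ is proportional to this function. Let $\mathsf H_n$ be the set of additive functionals $$h_n(x_{0:n})=h_0(x_0)+\sum_{m=0}^{n-1}\tilde h_m(x_m,x_{m+1})$$ with bounded measurable terms $h_0,\tilde h_m$. **Algorithm (AdaSmooth).** Let $\nu$ be a probability density on $\mathsf X_0$ dominating $\chi$ (that is, $\chi=0$ $\mu_0$-a.e. on $\{\nu=0\}$); for each $n$ let $p_n$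 be a transition density on $\mathsf X_n\times\mathsf X_{n+1}$ such that $p_n(x,\cdot)$ dominates $\ell_n(x,\cdot)$ for every $x\in\mathsf X_n$, and let $\vartheta_n:\mathsf X_n\to(0,\infty)$ be measurable (adjustment multipliers). Let $(\rho_n)_{n\in\mathbb N}$ (selection schedule) and $(\varepsilon_n)_{n\in\mathbb N}$ (backward-sampling schedule) be deterministic $\{0,1\}$-valued sequences with $\varepsilon_n=0$ whenever $\rho_n=0$. For $N\ge1$, draw $\xi_0^1,\dots,\xi_0^N$ independently from $\nu$ and set $\omega_0^i=\chi(\xi_0^i)/\nu(\xi_0^i)$ and $\tau_0^i=h_0(\xi_0^i)$. Given the output $(\xi_n^i,\tau_n^i,\omega_n^i)_{i=1}^N$ of the first $n$ iterations, perform, independently for $i=1,\dots,N$ and conditionally on the past: 1. If $\rho_n=1$, draw $I_{n+1}^i\sim\mathsf{Cat}\big((\omega_n^l\vartheta_n(\xi_n^l))_{l=1}^N\big)$; otherwise set $I_{n+1}^i=i$. 2. Draw $\xi_{n+1}^i\sim p_n(\xi_n^{I_{n+1}^i},\cdot)$ and set $$\omega_{n+1}^i=\frac{\ell_n(\xi_n^{I_{n+1}^i},\xi_{n+1}^i)}{p_n(\xi_n^{I_{n+1}^i},\xi_{n+1}^i)\,\vartheta_n(\xi_n^{I_{n+1}^i})^{\rho_n}}\,(\omega_n^i)^{1-\rho_n}.$$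 3. If $\varepsilon_n=1$, draw $J_{n+1}^i\sim\mathsf{Cat}\big((\omega_n^j\ell_n(\xi_n^j,\xi_{n+1}^i))_{j=1}^N\big)$ and set $$\tau_{n+1}^i=\tfrac12\Big(\tau_n^{I_{n+1}^i}+\tilde h_n(\xi_n^{I_{n+1}^i},\xi_{n+1}^i)+\tau_n^{J_{n+1}^i}+\tilde h_n(\xi_n^{J_{n+1}^i},\xi_{n+1}^i)\Big);$$ otherwise set $\tau_{n+1}^i=\tau_n^{I_{n+1}^i}+\tilde h_n(\xi_n^{I_{n+1}^i},\xi_{n+1}^i)$. Here $\mathsf{Cat}(a_1,\dots,a_N)$ is the distribution on $\{1,\dots,N\}$ with probabilities proportional to $a_1,\dots,a_N$, understood as the uniform distribution if all the $a_i$ vanish, and $0/0$ is read as $0$. Put $\Omega_n=\sum_{i=1}^N\omega_n^i$. The runs for all $N\ge1$ are defined on one common probability space with probability measure $\mathbb P$, with arbitrary dependence between different $N$. **Theorem 3.1 (strong consistency).** Assume that the functions $x\mapsto\chi(x)/\nu(x)$, $(x,x')\mapsto \ell_n(x,x')/\big(\vartheta_n(x)^{r}p_n(x,x')\big)$ and $\vartheta_n$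 are bounded, for every $n\in\mathbb N$ and $r\in\{0,1\}$. Then for every $n\in\mathbb N$ and every $h_n\in\mathsf H_n$, $$\lim_{N\to\infty}\sum_{i=1}^N\frac{\omega_n^i}{\Omega_n}\,\tau_n^i=\phi_{0:n}h_n=\int h_n\,d\phi_{0:n},\qquad\mathbb P\text{-a.s.}$$ -/

import Mathlib

open MeasureTheory Filter Topology
open scoped NNReal ENNReal

/-- A path-space model on the measurable spaces `X 0, X 1, …`: reference measures `mu n`, an
unnormalized initial density `chi` and unnormalized transition densities `ell n` (all densities
with respect to the reference measures).  The last two fields say that the path densities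
`chi (x 0) * ∏ m < n, ell m (x m) (x (m + 1))` can be normalized. -/
structure PathModel (X : ℕ → Type*) [∀ n, MeasurableSpace (X n)] where
  mu : ∀ n, Measure (X n)
  sigmaFinite_mu : ∀ n, SigmaFinite (mu n)
  chi : X 0 → ℝ≥0
  measurable_chi : Measurable chi
  ell : ∀ n, X n → X (n + 1) → ℝ≥0
  measurable_ell : ∀ n, Measurable (Function.uncurry (ell n))
  ell_bound : ∀ n, ⨆ x, ∫⁻ y, (ell n x y : ℝ≥0∞) ∂(mu (n + 1)) < ∞
  norm_ne_zero : ∀ n, ∫⁻ x : (∀ i : Fin (n + 1), X i),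
    ((chi (x ⟨0, n.succ_pos⟩) *
      ∏ m : Fin n, ell m (x ⟨m, m.2.trans n.lt_succ_self⟩) (x ⟨m + 1, Nat.succ_lt_succ m.2⟩) :
        ℝ≥0) : ℝ≥0∞) ∂(Measure.pi fun i : Fin (n + 1) => mu i) ≠ 0
  norm_ne_top : ∀ n, ∫⁻ x : (∀ i : Fin (n + 1), X i),
    ((chi (x ⟨0, n.succ_pos⟩) *
      ∏ m : Fin n, ell m (x ⟨m, m.2.trans n.lt_succ_self⟩) (x ⟨m + 1, Nat.succ_lt_succ m.2⟩) :
        ℝ≥0) : ℝ≥0∞) ∂(Measure.pi fun i : Fin (n + 1) => mu i) ≠ ∞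

namespace PathModel

variable {X : ℕ → Type*} [∀ n, MeasurableSpace (X n)]

attribute [instance] PathModel.sigmaFinite_mu

/-- The unnormalized path density `chi (x 0) * ∏ m < n, ell m (x m) (x (m + 1))`. -/
def pathDensity (M : PathModel X) (n : ℕ) (x : ∀ i : Fin (n + 1), X i) : ℝ≥0 :=
  M.chi (x ⟨0, n.succ_pos⟩) *
    ∏ m : Fin n, M.ell m (x ⟨m, m.2.trans n.lt_succ_self⟩) (x ⟨m + 1, Nat.succ_lt_succ m.2⟩)

/-- The normalizing constant of the path density. -/
noncomputable def normConst (M : PathModel X) (n : ℕ) : ℝ≥0∞ :=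
  ∫⁻ x, (M.pathDensity n x : ℝ≥0∞) ∂(Measure.pi fun i : Fin (n + 1) => M.mu i)

/-- The joint-smoothing distribution `φ_{0:n}` on `X 0 × ⋯ × X n`: the probability measure with
density proportional to `pathDensity`. -/
noncomputable def post (M : PathModel X) (n : ℕ) : Measure (∀ i : Fin (n + 1), X i) :=
  (M.normConst n)⁻¹ •
    (Measure.pi fun i : Fin (n + 1) => M.mu i).withDensity fun x => (M.pathDensity n x : ℝ≥0∞)

theorem isProbabilityMeasure_post (M : PathModel X) (n : ℕ) :
    IsProbabilityMeasure (M.post n) := by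
  constructor
  rw [post, Measure.smul_apply, withDensity_apply _ MeasurableSet.univ, Measure.restrict_univ,
    smul_eq_mul]
  exact ENNReal.inv_mul_cancel (M.norm_ne_zero n) (M.norm_ne_top n)

end PathModel

/-- Algorithmic parameters of the auxiliary particle filter: the initial proposal density `nu`,
the proposal transition densities `prop n` and the (positive) adjustment multipliers `adj n`.
The proposals dominate the corresponding model densities. -/
structure ApfParams {X : ℕ → Type*} [∀ n, MeasurableSpace (X n)] (M : PathModel X) where
  nu : X 0 → ℝ≥0
  measurable_nu : Measurable nu
  lintegral_nu : ∫⁻ x, (nu x : ℝ≥0∞) ∂(M.mu 0) = 1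
  nu_dominates : ∀ᵐ x ∂(M.mu 0), nu x = 0 → M.chi x = 0
  prop : ∀ n, X n → X (n + 1) → ℝ≥0
  measurable_prop : ∀ n, Measurable (Function.uncurry (prop n))
  lintegral_prop : ∀ n x, ∫⁻ y, (prop n x y : ℝ≥0∞) ∂(M.mu (n + 1)) = 1
  prop_dominates : ∀ n x, ∀ᵐ y ∂(M.mu (n + 1)), prop n x y = 0 → M.ell n x y = 0
  adj : ∀ n, X n → ℝ≥0
  measurable_adj : ∀ n, Measurable (adj n)
  adj_pos : ∀ n x, 0 < adj n x

namespace ApfParams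

variable {X : ℕ → Type*} [∀ n, MeasurableSpace (X n)] {M : PathModel X}

/-- The initial weight function `w_{-1} = χ / ν` (with value `0` where `ν` vanishes, a set which
is not charged by the proposal). -/
noncomputable def initWeight (A : ApfParams M) (x : X 0) : ℝ≥0 := M.chi x / A.nu x

/-- The weight function `w_n⟨r⟩(x, y) = ℓ_n(x, y) / (ϑ_n(x)^r p_n(x, y))` (with value `0` where
`p_n` vanishes, a set which is not charged by the proposal). -/
noncomputable def weightFun (A : ApfParams M) (n : ℕ) (r : Bool) (x : X n) (y : X (n + 1)) : ℝ≥0 :=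
  M.ell n x y / (A.adj n x ^ r.toNat * A.prop n x y)

/-- Boundedness of all weight functions, for every selection schedule, and of the adjustment
multipliers; the bounds may depend on the time index. -/
def BoundedWeights (A : ApfParams M) : Prop :=
  (∃ C : ℝ≥0, ∀ x, A.initWeight x ≤ C) ∧
  (∀ ρ : ℕ → Bool, ∀ n, ∃ C : ℝ≥0, ∀ x y, A.weightFun n (ρ n) x y ≤ C) ∧
  (∀ n, ∃ C : ℝ≥0, ∀ x, A.adj n x ≤ C)

/-- The law on `X 0` with density `nu`. -/
noncomputable def initLaw (A : ApfParams M) : Measure (X 0) :=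
  (M.mu 0).withDensity fun x => (A.nu x : ℝ≥0∞)

/-- The law on `X (n + 1)` with density `prop n x`. -/
noncomputable def propLaw (A : ApfParams M) (n : ℕ) (x : X n) : Measure (X (n + 1)) :=
  (M.mu (n + 1)).withDensity fun y => (A.prop n x y : ℝ≥0∞)

end ApfParams

/-- The bounded measurable terms of an additive state functional: `init` on `X 0` and
`incr n` on `X n × X (n + 1)`. -/
structure AdditiveTerms (X : ℕ → Type*) [∀ n, MeasurableSpace (X n)] where
  init : X 0 → ℝ
  measurable_init : Measurable init
  bounded_init : ∃ C : ℝ, ∀ x, |init x| ≤ C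
  incr : ∀ n, X n → X (n + 1) → ℝ
  measurable_incr : ∀ n, Measurable (Function.uncurry (incr n))
  bounded_incr : ∀ n, ∃ C : ℝ, ∀ x y, |incr n x y| ≤ C

/-- The additive functional `h_n(x_{0:n}) = h_0(x_0) + ∑ m < n, h̃_m(x_m, x_{m+1})`. -/
def AdditiveTerms.functional {X : ℕ → Type*} [∀ n, MeasurableSpace (X n)]
    (h : AdditiveTerms X) (n : ℕ) (x : ∀ i : Fin (n + 1), X i) : ℝ :=
  h.init (x ⟨0, n.succ_pos⟩) +
    ∑ m : Fin n, h.incr m (x ⟨m, m.2.trans n.lt_succ_self⟩) (x ⟨m + 1, Nat.succ_lt_succ m.2⟩)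

/-- The categorical distribution on `Fin N` with probabilities proportional to `a`.  If all the
`a i` vanish, it is understood as the uniform distribution. -/
noncomputable def cat {N : ℕ} (a : Fin N → ℝ≥0) : Measure (Fin N) :=
  if ∑ j, a j = 0 then ∑ i, ((N : ℝ≥0∞)⁻¹) • Measure.dirac i
  else ∑ i, ((a i / ∑ j, a j : ℝ≥0) : ℝ≥0∞) • Measure.dirac i

/-- `κ` is a (regular) conditional distribution of `Y` given the σ-field `m`. -/
def HasCondLaw {Ω E : Type*} [MeasurableSpace Ω] [MeasurableSpace E] (P : Measure Ω)
    (m : MeasurableSpace Ω) (Y : Ω → E) (κ : Ω → Measure E) : Prop :=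
  ∀ B : Set E, MeasurableSet B →
    Measurable[m] (fun ω => κ ω B) ∧
    ∀ A : Set Ω, MeasurableSet[m] A → P (A ∩ Y ⁻¹' B) = ∫⁻ ω in A, κ ω B ∂P

namespace AdaSmooth

variable {X : ℕ → Type*} [∀ n, MeasurableSpace (X n)] {M : PathModel X} {N : ℕ}

/-- The importance weights `ω_n^i` of the auxiliary particle filter with selection schedule `ρ`,
as a function of the particles `ξ_n^i` and of the ancestor indices `I_n^i` (`n ≥ 1`). -/
noncomputable def weight (A : ApfParams M) (ρ : ℕ → Bool) (ξ : ∀ n, Fin N → X n)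
    (I : ℕ → Fin N → Fin N) : ℕ → Fin N → ℝ≥0
  | 0, i => A.initWeight (ξ 0 i)
  | n + 1, i => A.weightFun n (ρ n) (ξ n (I (n + 1) i)) (ξ (n + 1) i) *
      (if ρ n = true then 1 else weight A ρ ξ I n i)

/-- The smoothing statistics `τ_n^i` with backward-sampling schedule `ε`, as a function of the
particles `ξ_n^i`, the ancestor indices `I_n^i` and the backward indices `J_n^i` (`n ≥ 1`). -/
noncomputable def stat (h : AdditiveTerms X) (ε : ℕ → Bool) (ξ : ∀ n, Fin N → X n)
    (I J : ℕ → Fin N → Fin N) : ℕ → Fin N → ℝ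
  | 0, i => h.init (ξ 0 i)
  | n + 1, i =>
    if ε n = true then
      2⁻¹ * (stat h ε ξ I J n (I (n + 1) i) + h.incr n (ξ n (I (n + 1) i)) (ξ (n + 1) i) +
        stat h ε ξ I J n (J (n + 1) i) + h.incr n (ξ n (J (n + 1) i)) (ξ (n + 1) i))
    else
      stat h ε ξ I J n (I (n + 1) i) + h.incr n (ξ n (I (n + 1) i)) (ξ (n + 1) i)

/-- The estimator `∑ i, (ω_n^i / Ω_n) τ_n^i`, where `Ω_n = ∑ i, ω_n^i`. -/
noncomputable def estimator (A : ApfParams M) (h : AdditiveTerms X) (ρ ε : ℕ → Bool)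
    (ξ : ∀ n, Fin N → X n) (I J : ℕ → Fin N → Fin N) (n : ℕ) : ℝ :=
  ∑ i, ((weight A ρ ξ I n i : ℝ) / ∑ j, (weight A ρ ξ I n j : ℝ)) * stat h ε ξ I J n i

/-- The law of the ancestor index `I_{n+1}^i`: the categorical distribution with weights
`ω_n^l ϑ_n(ξ_n^l)` if selection is active, and the point mass at `i` otherwise. -/
noncomputable def ancestorLaw (A : ApfParams M) (n : ℕ) (r : Bool) (x : Fin N → X n)
    (w : Fin N → ℝ≥0) (i : Fin N) : Measure (Fin N) :=
  if r = true then cat (fun l => w l * A.adj n (x l)) else Measure.dirac i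

/-- The law of the backward index `J_{n+1}^i`: the categorical distribution with weights
`ω_n^j ℓ_n(ξ_n^j, ξ_{n+1}^i)`; here `y = ξ_{n+1}^i`. -/
noncomputable def backwardLaw (M : PathModel X) (n : ℕ) (x : Fin N → X n)
    (w : Fin N → ℝ≥0) (y : X (n + 1)) : Measure (Fin N) :=
  cat (fun j => w j * M.ell n (x j) y)

/-- The σ-field generated by the output of the first `n` iterations of the algorithm, that is, by
`ξ_0` and by `I_m`, `ξ_m`, `τ_m` for `1 ≤ m ≤ n`. -/
@[reducible]
noncomputable def history {Ω : Type*} (h : AdditiveTerms X) (ε : ℕ → Bool) (ξ : ∀ n, Ω → Fin N → X n)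
    (I J : ℕ → Ω → Fin N → Fin N) : ℕ → MeasurableSpace Ω
  | 0 => MeasurableSpace.comap (ξ 0) inferInstance
  | n + 1 => history h ε ξ I J n ⊔ MeasurableSpace.comap (I (n + 1)) inferInstance ⊔
      MeasurableSpace.comap (ξ (n + 1)) inferInstance ⊔
      MeasurableSpace.comap
        (fun ω => stat h ε (fun k => ξ k ω) (fun k => I k ω) (fun k => J k ω) (n + 1))
        inferInstance

/-- The random variables `ξ_n^i` (particles), `I_n^i` (ancestor indices) and `J_n^i` (backward
indices), `1 ≤ i ≤ N`, on the probability space `(Ω, P)` are generated by the AdaSmooth algorithm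
with `N` particles, selection schedule `ρ` and backward-sampling schedule `ε`.  The index
variables at `n = 0`, and the backward indices `J_{n+1}^i` at times `n` with `ε n = false`, play no
role. -/
structure IsRun {Ω : Type*} [MeasurableSpace Ω] (P : Measure Ω) (A : ApfParams M)
    (h : AdditiveTerms X) (ρ ε : ℕ → Bool) (ξ : ∀ n, Ω → Fin N → X n)
    (I J : ℕ → Ω → Fin N → Fin N) : Prop where
  measurable_particle : ∀ n, Measurable (ξ n)
  measurable_ancestor : ∀ n, Measurable (I (n + 1))
  measurable_backward : ∀ n, ε n = true → Measurable (J (n + 1))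
  /-- The initial particles are independent draws from `nu`. -/
  init : P.map (ξ 0) = Measure.pi fun _ : Fin N => A.initLaw
  /-- Selection: given the history, the ancestor indices are independent draws from
  `ancestorLaw`. -/
  select : ∀ n, HasCondLaw P (history h ε ξ I J n) (I (n + 1)) fun ω =>
    Measure.pi fun i : Fin N =>
      ancestorLaw A n (ρ n) (ξ n ω) (weight A ρ (fun k => ξ k ω) (fun k => I k ω) n) i
  /-- Mutation: given the history and the ancestor indices, the new particles are independent
  draws from the proposal transition densities. -/
  mutate : ∀ n, HasCondLaw P
    (history h ε ξ I J n ⊔ MeasurableSpace.comap (I (n + 1)) inferInstance) (ξ (n + 1)) fun ω =>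
    Measure.pi fun i : Fin N => A.propLaw n (ξ n ω (I (n + 1) ω i))
  /-- Backward sampling, at the times prescribed by `ε`: given in addition the new particles, the
  backward indices are independent draws from `backwardLaw`. -/
  backward : ∀ n, ε n = true → HasCondLaw P
    (history h ε ξ I J n ⊔ MeasurableSpace.comap (I (n + 1)) inferInstance ⊔
      MeasurableSpace.comap (ξ (n + 1)) inferInstance) (J (n + 1)) fun ω =>
    Measure.pi fun i : Fin N =>
      backwardLaw M n (ξ n ω) (weight A ρ (fun k => ξ k ω) (fun k => I k ω) n) (ξ (n + 1) ω i)

end AdaSmooth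

/-! The quantity propagated in time is the weighted empirical mean `empMean` of `t i * f (x i) + g
(x i)`, for all bounded measurable pairs `(f, g)`. The limiting object is `PathModel.gamma`, the
integral of `h_n * f + g` against the unnormalized path density. This affine class is closed under
the dynamics: integrating out the last state replaces `f` by its transition integral, and sends the
increment times `f`, plus `g`, into the second slot (`gamma_succ`).

The probabilistic part says that one iteration stays close to its conditional mean. Averaging in
turn over the backward indices, the new particles and the ancestor indices splits the difference
into three centred means of conditionally independent variables, bounded by constants not depending
on `N`. A conditional Hoeffding inequality makes each deviation exponentially unlikely in `N`, and
Borel–Cantelli gives almost sure convergence to zero, whatever the dependence between runs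
(`ae_tendsto_runMean_succ_sub`).

The algebraic part computes the conditional mean. Backward sampling introduces no bias:
conditionally on the new position, an ancestor weighted by `w l * ell (x l) y` and the backward
index have the same law, so averaging their two contributions preserves the weighted sum
(`sum_mul_statMean`). Importance weighting cancels the proposal and the adjustment multiplier. What
remains is the empirical mean at time `n` of the transported pair, divided after selection by the
empirical mean of the multipliers.

Induction on `n` gives convergence to `c * gamma` with some `c > 0` common to all pairs
(`exists_ae_tendsto_runMean`). The estimator is the ratio of the pairs `(1, 0)` and `(0, 1)`, so `c`
cancels and the normalized smoothing integral is left. -/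

/-! ### Concentration of conditionally independent means, and Borel–Cantelli. -/

/-- Hoeffding's inequality for the two-sided deviation of a mean of bounded functions of the
coordinates of a product measure. -/
theorem measure_pi_deviation_le {E : Type*} [MeasurableSpace E] {N : ℕ} (hN : 1 ≤ N)
    (ν : Fin N → Measure E) [∀ i, IsProbabilityMeasure (ν i)] {f : Fin N → E → ℝ}
    (hf : ∀ i, Measurable (f i)) {C : ℝ} (hC : 0 < C) (hfC : ∀ i y, |f i y| ≤ C)
    {δ : ℝ} (hδ : 0 < δ) :
    Measure.pi ν {y | δ ≤ |(N : ℝ)⁻¹ * ∑ i, (f i (y i) - ∫ z, f i z ∂ν i)|} ≤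
      ENNReal.ofReal (2 * Real.exp (-(δ ^ 2 / (2 * C ^ 2)) * N)) := by
  have hN' : (0 : ℝ) < N := by exact_mod_cast hN
  have key : ∀ g : Fin N → E → ℝ, (∀ i, Measurable (g i)) → (∀ i y, |g i y| ≤ C) →
      (Measure.pi ν).real {y | N * δ ≤ ∑ i, (g i (y i) - ∫ z, g i z ∂ν i)} ≤
        Real.exp (-(δ ^ 2 / (2 * C ^ 2)) * N) := by
    intro g hg hgC
    have hind : ProbabilityTheory.iIndepFun
        (fun i (y : Fin N → E) => g i (y i) - ∫ z, g i z ∂ν i) (Measure.pi ν) :=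
      ProbabilityTheory.iIndepFun_pi (X := fun i z => g i z - ∫ z, g i z ∂ν i)
        fun i => ((hg i).sub_const _).aemeasurable
    have hsub : ∀ i ∈ Finset.univ, ProbabilityTheory.HasSubgaussianMGF
        (fun (y : Fin N → E) => g i (y i) - ∫ z, g i z ∂ν i) ((‖C - -C‖₊ / 2) ^ 2)
        (Measure.pi ν) := by
      intro i _
      have h1 := ProbabilityTheory.hasSubgaussianMGF_of_mem_Icc (μ := Measure.pi ν)
        (X := fun y => g i (y i)) (a := -C) (b := C)
        ((hg i).comp (measurable_pi_apply i)).aemeasurable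
        (Eventually.of_forall fun y => abs_le.1 (hgC i (y i)))
      have h2 : ∫ y, g i (y i) ∂(Measure.pi ν) = ∫ z, g i z ∂ν i := by
        rw [← (measurePreserving_eval ν i).map_eq, integral_map (measurable_pi_apply i).aemeasurable
          (hg i).aestronglyMeasurable]
      rwa [h2] at h1
    refine (ProbabilityTheory.HasSubgaussianMGF.measure_sum_ge_le_of_iIndepFun hind hsub
      (by positivity)).trans (Real.exp_le_exp.2 (le_of_eq ?_))
    -- Each variance proxy is `C ^ 2`, half the length of `[-C, C]` squared, so the sum has proxy `N
    -- * C ^ 2` and the threshold `N * δ` yields the exponent `N * δ ^ 2 / (2 * C ^ 2)`.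
    have h3 : ((‖C - -C‖₊ : ℝ≥0) : ℝ) = 2 * C := by
      rw [coe_nnnorm, Real.norm_eq_abs, abs_of_pos (by linarith)]; ring
    simp only [Finset.sum_const, Finset.card_univ, Fintype.card_fin]
    simp only [nsmul_eq_mul]
    push_cast [h3]
    field_simp
  -- The one-sided bound is used for `f` and for `-f`, whence the factor 2.
  have hsubset : {y : Fin N → E | δ ≤ |(N : ℝ)⁻¹ * ∑ i, (f i (y i) - ∫ z, f i z ∂ν i)|} ⊆
      {y | N * δ ≤ ∑ i, (f i (y i) - ∫ z, f i z ∂ν i)} ∪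
      {y | N * δ ≤ ∑ i, (-f i (y i) - ∫ z, -f i z ∂ν i)} := by
    intro y hy
    simp only [Set.mem_ofPred_eq, abs_mul, abs_inv, Nat.abs_cast] at hy
    rw [← div_eq_inv_mul, le_div_iff₀ hN'] at hy
    rcases le_abs.1 hy with h | h
    · left; simp only [Set.mem_ofPred_eq]; linarith
    · right
      simp only [Set.mem_ofPred_eq, integral_neg]
      have : ∑ i, (-f i (y i) - -∫ z, f i z ∂ν i) = -∑ i, (f i (y i) - ∫ z, f i z ∂ν i) := by
        rw [← Finset.sum_neg_distrib]; exact Finset.sum_congr rfl fun i _ => by ring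
      linarith
  refine (measure_mono hsubset).trans ((measure_union_le _ _).trans ?_)
  rw [two_mul, ENNReal.ofReal_add (by positivity) (by positivity)]
  refine add_le_add ?_ ?_
  · rw [← ofReal_measureReal]
    exact ENNReal.ofReal_le_ofReal (key f hf hfC)
  · rw [← ofReal_measureReal]
    exact ENNReal.ofReal_le_ofReal
      (key (fun i y => -f i y) (fun i => (hf i).neg) (fun i y => by rw [abs_neg]; exact hfC i y))

/-- If `K ∘ Z` is a conditional law of `Y` given `Z`, then the joint law of `Z` and `Y` is the
composition product of the law of `Z` with `K`. -/
theorem map_prodMk_eq_compProd {Ω W E : Type*} [MeasurableSpace Ω] [MeasurableSpace W]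
    [MeasurableSpace E] {P : Measure Ω} [IsFiniteMeasure P] {Z : Ω → W} (hZ : Measurable Z)
    {Y : Ω → E} (hY : Measurable Y) (K : ProbabilityTheory.Kernel W E)
    [ProbabilityTheory.IsMarkovKernel K]
    (hK : ∀ A B, MeasurableSet A → MeasurableSet B →
      P (Z ⁻¹' A ∩ Y ⁻¹' B) = ∫⁻ ω in Z ⁻¹' A, K (Z ω) B ∂P) :
    P.map (fun ω => (Z ω, Y ω)) = (P.map Z).compProd K := by
  refine Measure.ext_prod fun {A} {B} hA hB => ?_
  rw [Measure.map_apply (hZ.prodMk hY) (hA.prod hB), Measure.compProd_apply_prod hA hB,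
    setLIntegral_map hA (K.measurable_coe hB) hZ, ← hK A B hA hB]
  rfl

/-- Conditional Hoeffding inequality, given a random variable. -/
theorem measure_deviation_le {Ω W E : Type*} [MeasurableSpace Ω] [MeasurableSpace W]
    [MeasurableSpace E] {P : Measure Ω} [IsProbabilityMeasure P] {N : ℕ} (hN : 1 ≤ N)
    {Z : Ω → W} (hZ : Measurable Z) {Y : Ω → Fin N → E} (hY : Measurable Y)
    (κ : W → Fin N → Measure E) [∀ z i, IsProbabilityMeasure (κ z i)]
    (hκ : ∀ B, MeasurableSet B → Measurable fun z => Measure.pi (κ z) B)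
    (hlaw : ∀ A B, MeasurableSet A → MeasurableSet B →
      P (Z ⁻¹' A ∩ Y ⁻¹' B) = ∫⁻ ω in Z ⁻¹' A, Measure.pi (κ (Z ω)) B ∂P)
    {g : Fin N → W → E → ℝ} (hg : ∀ i, Measurable (Function.uncurry (g i)))
    {C : ℝ} (hC : 0 < C) (hgC : ∀ i z y, |g i z y| ≤ C) {δ : ℝ} (hδ : 0 < δ) :
    P {ω | δ ≤ |(N : ℝ)⁻¹ * ∑ i, (g i (Z ω) (Y ω i) - ∫ y, g i (Z ω) y ∂κ (Z ω) i)|} ≤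
      ENNReal.ofReal (2 * Real.exp (-(δ ^ 2 / (2 * C ^ 2)) * N)) := by
  let K : ProbabilityTheory.Kernel W (Fin N → E) :=
    ⟨fun z => Measure.pi (κ z), Measure.measurable_of_measurable_coe _ hκ⟩
  have hKM : ProbabilityTheory.IsMarkovKernel K := ⟨fun z => by
    change IsProbabilityMeasure (Measure.pi (κ z)); infer_instance⟩
  have hmarg : ∀ i, Measurable fun z => κ z i := by
    intro i
    refine Measure.measurable_of_measurable_coe _ fun B hB => ?_
    -- A marginal is the product measure of a cylinder, so it inherits measurability from the
    -- product kernel.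
    have : (fun z => κ z i B) = fun z => Measure.pi (κ z) (Function.eval i ⁻¹' B) := by
      funext z
      exact ((measurePreserving_eval (κ z) i).measure_preimage hB.nullMeasurableSet).symm
    rw [this]
    exact hκ _ (measurable_pi_apply i hB)
  have hint : ∀ i, Measurable fun z => ∫ y, g i z y ∂κ z i := by
    intro i
    let Ki : ProbabilityTheory.Kernel W E := ⟨fun z => κ z i, hmarg i⟩
    have : ProbabilityTheory.IsMarkovKernel Ki := ⟨fun z => by
      change IsProbabilityMeasure (κ z i); infer_instance⟩
    exact (StronglyMeasurable.integral_kernel_prod_right (κ := Ki)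
      (hg i).stronglyMeasurable).measurable
  let S : Set (W × (Fin N → E)) :=
    {p | δ ≤ |(N : ℝ)⁻¹ * ∑ i, (g i p.1 (p.2 i) - ∫ y, g i p.1 y ∂κ p.1 i)|}
  have hS : MeasurableSet S := by
    refine measurableSet_le measurable_const ?_
    refine (measurable_const.mul (Finset.measurable_sum _ fun i _ => ?_)).abs
    exact ((hg i).comp (measurable_fst.prodMk
      ((measurable_pi_apply i).comp measurable_snd))).sub ((hint i).comp measurable_fst)
  have h1 : P {ω | δ ≤ |(N : ℝ)⁻¹ * ∑ i, (g i (Z ω) (Y ω i) - ∫ y, g i (Z ω) y ∂κ (Z ω) i)|} =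
      ((P.map Z).compProd K) S := by
    rw [← map_prodMk_eq_compProd hZ hY K hlaw, Measure.map_apply (hZ.prodMk hY) hS]
    rfl
  rw [h1, Measure.compProd_apply hS]
  have : IsProbabilityMeasure (P.map Z) := Measure.isProbabilityMeasure_map hZ.aemeasurable
  refine (lintegral_mono (g := fun _ => _) fun z => ?_).trans
    (by rw [lintegral_const, measure_univ, mul_one])
  exact measure_pi_deviation_le hN (κ z) (fun i => (hg i).comp measurable_prodMk_left) hC
    (fun i y => hgC i z y) hδ

/-- Conditional Hoeffding inequality, given a σ-field. -/
theorem HasCondLaw.measure_deviation_le {Ω E : Type*} {m m₀ : MeasurableSpace Ω}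
    [MeasurableSpace E] {P : Measure Ω} [IsProbabilityMeasure P] {N : ℕ} (hN : 1 ≤ N)
    (hm : m ≤ m₀) {Y : Ω → Fin N → E} (hY : Measurable Y)
    {κ : Ω → Fin N → Measure E} [∀ ω i, IsProbabilityMeasure (κ ω i)]
    (hlaw : HasCondLaw P m Y fun ω => Measure.pi (κ ω))
    {g : Fin N → Ω → E → ℝ} (hg : ∀ i, Measurable[m.prod inferInstance] (Function.uncurry (g i)))
    {C : ℝ} (hC : 0 < C) (hgC : ∀ i ω y, |g i ω y| ≤ C) {δ : ℝ} (hδ : 0 < δ) :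
    P {ω | δ ≤ |(N : ℝ)⁻¹ * ∑ i, (g i ω (Y ω i) - ∫ y, g i ω y ∂κ ω i)|} ≤
      ENNReal.ofReal (2 * Real.exp (-(δ ^ 2 / (2 * C ^ 2)) * N)) :=
  -- Conditioning on `m` is conditioning on the identity, seen as a measurable map from `(Ω, m₀)` to
  -- `(Ω, m)`.
  @_root_.measure_deviation_le Ω Ω E m₀ m _ P _ N hN id (measurable_id'' hm) Y hY κ _
    (fun B hB => (hlaw B hB).1) (fun A B hA hB => (hlaw B hB).2 A hA) g hg C hC hgC δ hδ

/-- Borel–Cantelli: exponentially decaying deviation probabilities give almost sure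
convergence to zero. -/
theorem ae_tendsto_zero_of_measure_le {Ω : Type*} [MeasurableSpace Ω] {P : Measure Ω}
    [IsProbabilityMeasure P] {D : ℕ → Ω → ℝ} {C : ℝ} (hC : 0 < C)
    (hD : ∀ N, 1 ≤ N → ∀ δ : ℝ, 0 < δ → P {ω | δ ≤ |D N ω|} ≤
      ENNReal.ofReal (2 * Real.exp (-(δ ^ 2 / (2 * C ^ 2)) * N))) :
    ∀ᵐ ω ∂P, Tendsto (fun N => D N ω) atTop (𝓝 0) := by
  -- Countably many thresholds `1 / (k + 1)` suffice, so the exceptional sets have a null union.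
  have h1 : ∀ k : ℕ, ∀ᵐ ω ∂P, ∀ᶠ N in atTop, |D N ω| < 1 / ((k : ℝ) + 1) := by
    intro k
    have hδ : (0 : ℝ) < 1 / ((k : ℝ) + 1) := by positivity
    set δ : ℝ := 1 / ((k : ℝ) + 1)
    have hs : Summable fun N : ℕ => 2 * Real.exp (-(δ ^ 2 / (2 * C ^ 2)) * N) := by
      refine Summable.mul_left 2 ?_
      have hlt : Real.exp (-(δ ^ 2 / (2 * C ^ 2))) < 1 :=
        Real.exp_lt_one_iff.2 (neg_neg_of_pos (by positivity))
      refine (summable_geometric_of_lt_one (Real.exp_pos _).le hlt).congr fun N => ?_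
      rw [← Real.exp_nat_mul, mul_comm]
    -- The index is shifted because the tail bound is only available for `1 ≤ N`.
    have hfin : ∑' N, P {ω | δ ≤ |D (N + 1) ω|} ≠ ∞ := by
      refine ne_top_of_le_ne_top ?_ (ENNReal.tsum_le_tsum fun N => hD (N + 1) (by omega) δ hδ)
      exact ((summable_nat_add_iff 1).2 hs).tsum_ofReal_ne_top
    filter_upwards [ae_eventually_notMem hfin] with ω hω
    obtain ⟨a, ha⟩ := eventually_atTop.1 hω
    refine eventually_atTop.2 ⟨a + 1, fun N hN => ?_⟩
    obtain ⟨b, rfl⟩ : ∃ b, N = b + 1 := ⟨N - 1, by omega⟩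
    simpa using ha b (by omega)
  filter_upwards [ae_all_iff.2 h1] with ω hω
  rw [Metric.tendsto_nhds]
  intro e he
  obtain ⟨k, hk⟩ := exists_nat_one_div_lt he
  filter_upwards [hω k] with N hN
  rw [Real.dist_eq, sub_zero]
  exact hN.trans hk

/-! ### Bounded measurable test functions and additive functionals. -/

/-- Bounded measurable real functions. -/
structure BoundedMeasurable {E : Type*} [MeasurableSpace E] (f : E → ℝ) : Prop where
  measurable : Measurable f
  bounded : ∃ C : ℝ, ∀ x, |f x| ≤ C

namespace BoundedMeasurable

variable {E : Type*} [MeasurableSpace E] {f g : E → ℝ}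

theorem exists_pos_bound (hf : BoundedMeasurable f) : ∃ C : ℝ, 0 < C ∧ ∀ x, |f x| ≤ C := by
  obtain ⟨C, hC⟩ := hf.bounded
  exact ⟨max C 1, by positivity, fun x => (hC x).trans (le_max_left _ _)⟩

theorem const (c : ℝ) : BoundedMeasurable fun _ : E => c :=
  ⟨measurable_const, |c|, fun _ => le_rfl⟩

theorem add (hf : BoundedMeasurable f) (hg : BoundedMeasurable g) :
    BoundedMeasurable fun x => f x + g x := by
  obtain ⟨C, hC⟩ := hf.bounded
  obtain ⟨D, hD⟩ := hg.bounded
  exact ⟨hf.measurable.add hg.measurable, C + D,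
    fun x => (abs_add_le _ _).trans (add_le_add (hC x) (hD x))⟩

theorem mul (hf : BoundedMeasurable f) (hg : BoundedMeasurable g) :
    BoundedMeasurable fun x => f x * g x := by
  obtain ⟨C, hC, hfC⟩ := hf.exists_pos_bound
  obtain ⟨D, hD⟩ := hg.bounded
  exact ⟨hf.measurable.mul hg.measurable, C * D, fun x => by
    rw [abs_mul]; exact mul_le_mul (hfC x) (hD x) (abs_nonneg _) hC.le⟩

theorem comp {F : Type*} [MeasurableSpace F] (hf : BoundedMeasurable f) {u : F → E}
    (hu : Measurable u) : BoundedMeasurable fun x => f (u x) :=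
  ⟨hf.measurable.comp hu, hf.bounded.imp fun _ h x => h (u x)⟩

theorem sum {ι : Type*} (s : Finset ι) {f : ι → E → ℝ}
    (hf : ∀ i ∈ s, BoundedMeasurable (f i)) : BoundedMeasurable fun x => ∑ i ∈ s, f i x := by
  classical
  induction s using Finset.induction_on with
  | empty => simpa using const 0
  | insert a s ha ih =>
    simp only [Finset.sum_insert ha]
    exact (hf a (by simp)).add (ih fun i hi => hf i (by simp [hi]))

theorem integrable_mul {μ : Measure E} (hf : BoundedMeasurable f) (hg : Integrable g μ) :
    Integrable (fun x => g x * f x) μ := by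
  obtain ⟨C, hC⟩ := hf.bounded
  exact hg.mul_bdd (c := C) hf.measurable.aestronglyMeasurable (Eventually.of_forall hC)

end BoundedMeasurable

theorem measurable_pathPair {X : ℕ → Type*} [∀ n, MeasurableSpace (X n)] (n : ℕ) (m : Fin n) :
    Measurable fun x : (∀ i : Fin (n + 1), X i) => ((x ⟨m, m.2.trans n.lt_succ_self⟩,
      x ⟨m + 1, Nat.succ_lt_succ m.2⟩) : X m × X (m + 1)) :=
  (measurable_pi_apply (⟨m, m.2.trans n.lt_succ_self⟩ : Fin (n + 1))).prodMk
    (measurable_pi_apply (⟨m + 1, Nat.succ_lt_succ m.2⟩ : Fin (n + 1)))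

namespace AdditiveTerms

variable {X : ℕ → Type*} [∀ n, MeasurableSpace (X n)] (h : AdditiveTerms X)

theorem boundedMeasurable_init : BoundedMeasurable h.init := ⟨h.measurable_init, h.bounded_init⟩

theorem boundedMeasurable_incr (n : ℕ) : BoundedMeasurable (Function.uncurry (h.incr n)) :=
  ⟨h.measurable_incr n, (h.bounded_incr n).imp fun _ hC p => hC p.1 p.2⟩

theorem boundedMeasurable_functional (n : ℕ) : BoundedMeasurable (h.functional n) := by
  unfold functional
  exact (h.boundedMeasurable_init.comp
      (measurable_pi_apply (X := fun i : Fin (n + 1) => X i) ⟨0, n.succ_pos⟩)).add <|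
    BoundedMeasurable.sum Finset.univ
      (f := fun (m : Fin n) (x : ∀ i : Fin (n + 1), X i) =>
        h.incr m (x ⟨m, m.2.trans n.lt_succ_self⟩) (x ⟨m + 1, Nat.succ_lt_succ m.2⟩))
      fun m _ => (h.boundedMeasurable_incr m).comp (measurable_pathPair n m)

end AdditiveTerms

/-! ### Path space and the recursion for the unnormalized smoothing functional. -/

namespace PathModel

variable {X : ℕ → Type*}

/-- Append a state at time `n + 1` to a path of length `n + 1`. -/
def snocPath (n : ℕ) (p : (∀ i : Fin (n + 1), X i) × X (n + 1)) : ∀ i : Fin (n + 2), X i :=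
  Fin.snoc (α := fun i : Fin (n + 2) => X i) p.1 p.2

theorem snocPath_castSucc (n : ℕ) (p : (∀ i : Fin (n + 1), X i) × X (n + 1)) (i : Fin (n + 1)) :
    snocPath n p i.castSucc = p.1 i :=
  Fin.snoc_castSucc (α := fun i : Fin (n + 2) => X i) _ _ _

theorem snocPath_last (n : ℕ) (p : (∀ i : Fin (n + 1), X i) × X (n + 1)) :
    snocPath n p (Fin.last (n + 1)) = p.2 :=
  Fin.snoc_last (α := fun i : Fin (n + 2) => X i) _ _

variable [∀ n, MeasurableSpace (X n)]

theorem measurable_snocPath (n : ℕ) : Measurable (snocPath (X := X) n) := by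
  refine measurable_pi_iff.2 fun i => ?_
  refine Fin.lastCases ?_ (fun j => ?_) i
  · have : (fun p => snocPath n p (Fin.last (n + 1))) =
        (Prod.snd : (∀ i : Fin (n + 1), X i) × X (n + 1) → X (n + 1)) :=
      funext fun p => snocPath_last n p
    rw [this]
    exact measurable_snd
  · have : (fun p => snocPath n p j.castSucc) =
        fun p : (∀ i : Fin (n + 1), X i) × X (n + 1) => p.1 j :=
      funext fun p => snocPath_castSucc n p j
    rw [this]
    exact (measurable_pi_apply j).comp measurable_fst

/-- It suffices to compare the measures of boxes, whose preimages under `snocPath` are again boxes.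
This lets Fubini isolate the last state. -/
theorem map_snocPath (M : PathModel X) (n : ℕ) :
    ((Measure.pi fun i : Fin (n + 1) => M.mu i).prod (M.mu (n + 1))).map (snocPath n) =
      Measure.pi fun i : Fin (n + 2) => M.mu i := by
  symm
  refine Measure.pi_eq fun s hs => ?_
  rw [Measure.map_apply (measurable_snocPath n) (MeasurableSet.univ_pi hs)]
  have : snocPath n ⁻¹' (Set.univ.pi s) =
      (Set.univ.pi fun i : Fin (n + 1) => s i.castSucc) ×ˢ s (Fin.last (n + 1)) := by
    ext p
    simp only [Set.mem_preimage, Set.mem_pi, Set.mem_univ, forall_true_left, Set.mem_prod,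
      Fin.forall_fin_succ', snocPath_castSucc, snocPath_last]
  rw [this, Measure.prod_prod, Fin.prod_univ_castSucc]
  congr 1
  exact Measure.pi_pi (fun i : Fin (n + 1) => M.mu i) fun i => s i.castSucc

theorem pathDensity_snocPath (M : PathModel X) (n : ℕ)
    (p : (∀ i : Fin (n + 1), X i) × X (n + 1)) :
    M.pathDensity (n + 1) (snocPath n p) =
      M.pathDensity n p.1 * M.ell n (p.1 (Fin.last n)) p.2 := by
  have h1 : ∀ i : Fin (n + 1), snocPath n p ⟨i, i.2.trans (n + 1).lt_succ_self⟩ = p.1 i :=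
    fun i => snocPath_castSucc n p i
  have h2 : snocPath n p ⟨n + 1, Nat.lt_succ_self _⟩ = p.2 := snocPath_last n p
  rw [pathDensity, pathDensity, Fin.prod_univ_castSucc, mul_assoc]
  refine congrArg₂ _ (congrArg _ (h1 0)) (congrArg₂ _ (Finset.prod_congr rfl fun m _ => ?_) ?_)
  · exact congrArg₂ _ (h1 m.castSucc) (h1 m.succ)
  · exact congrArg₂ _ (h1 (Fin.last n)) h2

theorem functional_snocPath (h : AdditiveTerms X) (n : ℕ)
    (p : (∀ i : Fin (n + 1), X i) × X (n + 1)) :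
    h.functional (n + 1) (snocPath n p) =
      h.functional n p.1 + h.incr n (p.1 (Fin.last n)) p.2 := by
  have h1 : ∀ i : Fin (n + 1), snocPath n p ⟨i, i.2.trans (n + 1).lt_succ_self⟩ = p.1 i :=
    fun i => snocPath_castSucc n p i
  have h2 : snocPath n p ⟨n + 1, Nat.lt_succ_self _⟩ = p.2 := snocPath_last n p
  rw [AdditiveTerms.functional, AdditiveTerms.functional, Fin.sum_univ_castSucc, ← add_assoc]
  refine congrArg₂ _ (congrArg₂ _ (congrArg _ (h1 0)) (Finset.sum_congr rfl fun m _ => ?_)) ?_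
  · exact congrArg₂ _ (h1 m.castSucc) (h1 m.succ)
  · exact congrArg₂ _ (h1 (Fin.last n)) h2

variable (M : PathModel X)

theorem measurable_pathDensity (n : ℕ) : Measurable (M.pathDensity n) := by
  unfold pathDensity
  exact (M.measurable_chi.comp
      (measurable_pi_apply (X := fun i : Fin (n + 1) => X i) ⟨0, n.succ_pos⟩)).mul <|
    Finset.measurable_prod Finset.univ
      (f := fun (m : Fin n) (x : ∀ i : Fin (n + 1), X i) =>
        M.ell m (x ⟨m, m.2.trans n.lt_succ_self⟩) (x ⟨m + 1, Nat.succ_lt_succ m.2⟩))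
      fun m _ => (M.measurable_ell m).comp (measurable_pathPair n m)

theorem integrable_pathDensity (n : ℕ) :
    Integrable (fun x => (M.pathDensity n x : ℝ)) (Measure.pi fun i : Fin (n + 1) => M.mu i) := by
  refine ⟨(M.measurable_pathDensity n).coe_nnreal_real.aestronglyMeasurable, ?_⟩
  rw [HasFiniteIntegral]
  refine lt_of_le_of_lt (le_of_eq ?_) (M.norm_ne_top n).lt_top
  exact lintegral_congr fun x => by rw [enorm_eq_nnnorm, NNReal.nnnorm_eq]; rfl

theorem integrable_ell (n : ℕ) (x : X n) :
    Integrable (fun y => (M.ell n x y : ℝ)) (M.mu (n + 1)) := by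
  refine ⟨((M.measurable_ell n).comp
    measurable_prodMk_left).coe_nnreal_real.aestronglyMeasurable, ?_⟩
  rw [HasFiniteIntegral]
  refine lt_of_le_of_lt ?_ (M.ell_bound n)
  refine le_trans (le_of_eq ?_) (le_iSup _ x)
  exact lintegral_congr fun y => by rw [enorm_eq_nnnorm, NNReal.nnnorm_eq]

/-- The unnormalized transition operator `φ ↦ ∫ ℓ_n(x, y) φ(x, y) dy`. -/
noncomputable def trans (n : ℕ) (φ : X n → X (n + 1) → ℝ) (x : X n) : ℝ :=
  ∫ y, (M.ell n x y : ℝ) * φ x y ∂(M.mu (n + 1))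

theorem boundedMeasurable_trans (n : ℕ) {φ : X n → X (n + 1) → ℝ}
    (hφ : BoundedMeasurable (Function.uncurry φ)) : BoundedMeasurable (M.trans n φ) := by
  obtain ⟨C, hC, hφC⟩ := hφ.exists_pos_bound
  refine ⟨?_, C * (⨆ x, ∫⁻ y, (M.ell n x y : ℝ≥0∞) ∂(M.mu (n + 1))).toReal, fun x => ?_⟩
  · exact (StronglyMeasurable.integral_prod_right (ν := M.mu (n + 1)) (f := fun x y => (M.ell n x y : ℝ) * φ x y)
      ((M.measurable_ell n).coe_nnreal_real.mul hφ.measurable).stronglyMeasurable).measurable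
  · rw [← Real.norm_eq_abs, trans]
    refine (norm_integral_le_of_norm_le ((M.integrable_ell n x).const_mul C)
      (Eventually.of_forall fun y => ?_)).trans ?_
    · rw [norm_mul, Real.norm_of_nonneg (NNReal.coe_nonneg _), mul_comm]
      exact mul_le_mul_of_nonneg_right (hφC (x, y)) (NNReal.coe_nonneg _)
    · rw [integral_const_mul]
      refine mul_le_mul_of_nonneg_left ?_ hC.le
      rw [integral_eq_lintegral_of_nonneg_ae (Eventually.of_forall fun y => NNReal.coe_nonneg _)
        (M.integrable_ell n x).aestronglyMeasurable]
      simp only [ENNReal.ofReal_coe_nnreal]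
      exact ENNReal.toReal_mono (M.ell_bound n).ne
        (le_iSup (fun x => ∫⁻ y, (M.ell n x y : ℝ≥0∞) ∂(M.mu (n + 1))) x)

/-- The unnormalized smoothing functional: the integral of `h_n(x_{0:n}) f(x_n) + g(x_n)` against
the unnormalized path density. -/
noncomputable def gamma (h : AdditiveTerms X) (n : ℕ) (f g : X n → ℝ) : ℝ :=
  ∫ x, (M.pathDensity n x : ℝ) * (h.functional n x * f (x (Fin.last n)) + g (x (Fin.last n)))
    ∂(Measure.pi fun i : Fin (n + 1) => M.mu i)

theorem boundedMeasurable_functional_mul_add (h : AdditiveTerms X) (n : ℕ) {f g : X n → ℝ}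
    (hf : BoundedMeasurable f) (hg : BoundedMeasurable g) :
    BoundedMeasurable fun x : (∀ i : Fin (n + 1), X i) =>
      h.functional n x * f (x (Fin.last n)) + g (x (Fin.last n)) :=
  ((h.boundedMeasurable_functional n).mul
    (hf.comp (measurable_pi_apply (Fin.last n)))).add (hg.comp (measurable_pi_apply (Fin.last n)))

theorem gamma_zero (h : AdditiveTerms X) {f g : X 0 → ℝ} :
    M.gamma h 0 f g = ∫ x, (M.chi x : ℝ) * (h.init x * f x + g x) ∂(M.mu 0) := by
  have hp := measurePreserving_piUnique (X := fun i : Fin 1 => X i) fun i : Fin 1 => M.mu i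
  have h2 := hp.integral_comp (MeasurableEquiv.measurableEmbedding _)
    (fun x : X 0 => (M.chi x : ℝ) * (h.init x * f x + g x))
  refine Eq.trans ?_ h2
  refine integral_congr_ae (Eventually.of_forall fun x => ?_)
  simp only [pathDensity, AdditiveTerms.functional, Finset.univ_eq_empty, Finset.prod_empty,
    Finset.sum_empty, mul_one, add_zero]
  rfl

/-- Density and functional split as `pathDensity * ell` and `functional + incr`, so the integral
over the last state is again affine in the functional at time `n`. This is why pairs `(f, g)` are
carried along instead of single functions. -/
theorem gamma_succ (h : AdditiveTerms X) (n : ℕ) {f g : X (n + 1) → ℝ}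
    (hf : BoundedMeasurable f) (hg : BoundedMeasurable g) :
    M.gamma h (n + 1) f g = M.gamma h n (M.trans n fun _ y => f y)
      (M.trans n fun x y => h.incr n x y * f y + g y) := by
  have hint : Integrable (fun x => (M.pathDensity (n + 1) x : ℝ) *
      (h.functional (n + 1) x * f (x (Fin.last (n + 1))) + g (x (Fin.last (n + 1)))))
      (Measure.pi fun i : Fin (n + 2) => M.mu i) :=
    (boundedMeasurable_functional_mul_add h (n + 1) hf hg).integrable_mul
      (M.integrable_pathDensity (n + 1))
  rw [← M.map_snocPath n] at hint
  rw [gamma, ← M.map_snocPath n,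
    integral_map (measurable_snocPath n).aemeasurable hint.aestronglyMeasurable]
  have hint2 := hint.comp_measurable (measurable_snocPath n)
  simp only [Function.comp_def] at hint2
  rw [integral_prod _ hint2, gamma]
  refine integral_congr_ae (Eventually.of_forall fun x => ?_)
  simp only [pathDensity_snocPath, functional_snocPath, snocPath_last, trans, NNReal.coe_mul]
  have i1 : Integrable (fun y => (M.ell n (x (Fin.last n)) y : ℝ) * f y) (M.mu (n + 1)) :=
    hf.integrable_mul (M.integrable_ell n _)
  have i2 : Integrable (fun y => (M.ell n (x (Fin.last n)) y : ℝ) *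
      (h.incr n (x (Fin.last n)) y * f y + g y)) (M.mu (n + 1)) :=
    BoundedMeasurable.integrable_mul ((((h.boundedMeasurable_incr n).comp
      (u := fun y => (x (Fin.last n), y)) measurable_prodMk_left).mul hf).add hg)
      (M.integrable_ell n _)
  rw [← integral_const_mul, ← integral_add (i1.const_mul _) i2, ← integral_const_mul]
  refine integral_congr_ae (Eventually.of_forall fun y => ?_)
  simp only
  ring

/-- A nonnegative integrand with zero integral vanishes almost everywhere; since `g` is positive,
the path density would too, against `norm_ne_zero`. This justifies every division by a limit later
on. -/
theorem gamma_zero_pos (h : AdditiveTerms X) (n : ℕ) {g : X n → ℝ} (hg : BoundedMeasurable g)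
    (hpos : ∀ x, 0 < g x) : 0 < M.gamma h n (fun _ => 0) g := by
  have hint : Integrable (fun x => (M.pathDensity n x : ℝ) *
      (h.functional n x * 0 + g (x (Fin.last n)))) (Measure.pi fun i : Fin (n + 1) => M.mu i) :=
    (boundedMeasurable_functional_mul_add h n (BoundedMeasurable.const 0) hg).integrable_mul
      (M.integrable_pathDensity n)
  have hnn : ∀ x, 0 ≤ (M.pathDensity n x : ℝ) * (h.functional n x * 0 + g (x (Fin.last n))) :=
    fun x => by
      rw [mul_zero, zero_add]
      exact mul_nonneg (NNReal.coe_nonneg _) (hpos _).le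
  refine lt_of_le_of_ne (integral_nonneg hnn) fun h0 => M.norm_ne_zero n ?_
  have h1 := (integral_eq_zero_iff_of_nonneg hnn hint).1 h0.symm
  refine (lintegral_congr_ae ?_).trans lintegral_zero
  filter_upwards [h1] with x hx
  have h2 : (M.pathDensity n x : ℝ) = 0 := by
    simpa [(hpos (x (Fin.last n))).ne'] using hx
  rw [NNReal.coe_eq_zero] at h2
  exact ENNReal.coe_eq_zero.2 h2

theorem integral_post (h : AdditiveTerms X) (n : ℕ) :
    ∫ x, h.functional n x ∂(M.post n) =
      M.gamma h n (fun _ => 1) (fun _ => 0) / M.gamma h n (fun _ => 0) (fun _ => 1) := by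
  have h1 : M.gamma h n (fun _ => 0) (fun _ => 1) = (M.normConst n).toReal := by
    simp only [gamma, mul_zero, zero_add, mul_one]
    rw [integral_eq_lintegral_of_nonneg_ae (Eventually.of_forall fun y => NNReal.coe_nonneg _)
      (M.integrable_pathDensity n).aestronglyMeasurable]
    simp only [ENNReal.ofReal_coe_nnreal]
    rfl
  rw [h1, post, integral_smul_measure,
    integral_withDensity_eq_integral_smul (M.measurable_pathDensity n), gamma, ENNReal.toReal_inv,
    smul_eq_mul, inv_mul_eq_div]
  congr 1
  refine integral_congr_ae (Eventually.of_forall fun x => ?_)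
  simp only [mul_one, add_zero, NNReal.smul_def, smul_eq_mul]

end PathModel

/-! ### Integration against the categorical and proposal laws. -/

/-- The probability that the categorical distribution `cat a` gives to `j`. -/
noncomputable def catProb {N : ℕ} (a : Fin N → ℝ≥0) (j : Fin N) : ℝ :=
  if ∑ k, a k = 0 then (N : ℝ)⁻¹ else ((a j / ∑ k, a k : ℝ≥0) : ℝ)

theorem measurable_catProb {N : ℕ} (j : Fin N) :
    Measurable fun a : Fin N → ℝ≥0 => catProb a j := by
  have hs : Measurable fun a : Fin N → ℝ≥0 => ∑ k, a k :=
    Finset.measurable_sum _ fun k _ => measurable_pi_apply k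
  exact Measurable.ite (hs (measurableSet_singleton 0)) measurable_const
    ((measurable_pi_apply j).div hs).coe_nnreal_real

theorem integral_cat {N : ℕ} (a : Fin N → ℝ≥0) (φ : Fin N → ℝ) :
    ∫ j, φ j ∂(cat a) = ∑ j, catProb a j * φ j := by
  unfold cat catProb
  split_ifs with h0
  · rw [integral_finsetSum_measure fun i _ => Integrable.of_finite.smul_measure (by
      have : N ≠ 0 := fun h => (h ▸ i).elim0
      simpa using this)]
    simp
  · rw [integral_finsetSum_measure fun i _ => Integrable.of_finite.smul_measure
      ENNReal.coe_ne_top]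
    simp [NNReal.smul_def]

theorem isProbabilityMeasure_cat {N : ℕ} (hN : 1 ≤ N) (a : Fin N → ℝ≥0) :
    IsProbabilityMeasure (cat a) := by
  constructor
  unfold cat
  split_ifs with h0
  · have : (N : ℝ≥0∞) ≠ 0 := by exact_mod_cast (by omega : N ≠ 0)
    simp [ENNReal.mul_inv_cancel this]
  · simp only [Measure.coe_finsetSum, Measure.coe_smul, Finset.sum_apply, Pi.smul_apply,
      measure_univ, smul_eq_mul, mul_one]
    rw [← ENNReal.ofNNReal_finsetSum, ← Finset.sum_div, div_self h0, ENNReal.coe_one]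

/-- The index ranges over a countable type, so evaluation may be checked one index at a time. -/
theorem Measurable.eval_index {α E : Type*} {mα : MeasurableSpace α} [MeasurableSpace E] {N : ℕ}
    {x : α → Fin N → E} (hx : Measurable x) {l : α → Fin N} (hl : Measurable l) :
    Measurable fun a => x a (l a) := by
  have h : Measurable fun p : (Fin N → E) × Fin N => p.1 p.2 :=
    measurable_from_prod_countable_left fun i => measurable_pi_apply i
  exact h.comp (hx.prodMk hl)

theorem abs_integral_le_of_abs_le {E : Type*} [MeasurableSpace E] (μ : Measure E)
    [IsProbabilityMeasure μ] {f : E → ℝ} {C : ℝ} (hf : ∀ x, |f x| ≤ C) :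
    |∫ x, f x ∂μ| ≤ C := by
  simpa using norm_integral_le_of_norm_le_const (μ := μ) (f := f) (C := C)
    (Eventually.of_forall hf)

namespace ApfParams

variable {X : ℕ → Type*} [∀ n, MeasurableSpace (X n)] {M : PathModel X} (A : ApfParams M)

instance isProbabilityMeasure_initLaw : IsProbabilityMeasure A.initLaw :=
  ⟨by rw [initLaw, withDensity_apply _ MeasurableSet.univ, Measure.restrict_univ, A.lintegral_nu]⟩

instance isProbabilityMeasure_propLaw (n : ℕ) (x : X n) : IsProbabilityMeasure (A.propLaw n x) :=
  ⟨by rw [propLaw, withDensity_apply _ MeasurableSet.univ, Measure.restrict_univ,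
    A.lintegral_prop]⟩

/-- Change of measure: `nu` cancels where it is nonzero, and where it vanishes domination makes
`chi` vanish almost everywhere. -/
theorem integral_initLaw (φ : X 0 → ℝ) :
    ∫ x, (A.initWeight x : ℝ) * φ x ∂A.initLaw = ∫ x, (M.chi x : ℝ) * φ x ∂(M.mu 0) := by
  rw [initLaw, integral_withDensity_eq_integral_smul A.measurable_nu]
  refine integral_congr_ae ?_
  filter_upwards [A.nu_dominates] with x hx
  rw [NNReal.smul_def, smul_eq_mul, ← mul_assoc]
  congr 1
  by_cases h0 : A.nu x = 0
  · simp [h0, hx h0]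
  · rw [initWeight, ← NNReal.coe_mul, mul_div_cancel₀ _ h0]

theorem integral_propLaw (n : ℕ) (x : X n) (φ : X (n + 1) → ℝ) :
    ∫ y, φ y ∂(A.propLaw n x) = ∫ y, (A.prop n x y : ℝ) * φ y ∂(M.mu (n + 1)) := by
  exact integral_withDensity_eq_integral_smul
    ((A.measurable_prop n).comp measurable_prodMk_left) φ

/-- The proposal density cancels, by domination where it vanishes. Only the power of the adjustment
multiplier survives, to be absorbed by the selection probabilities. -/
theorem integral_weightFun_propLaw (n : ℕ) (r : Bool) (x : X n) (φ : X (n + 1) → ℝ) :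
    ∫ y, (A.weightFun n r x y : ℝ) * φ y ∂(A.propLaw n x) =
      ((A.adj n x : ℝ) ^ r.toNat)⁻¹ * M.trans n (fun _ y => φ y) x := by
  rw [integral_propLaw, PathModel.trans, ← integral_const_mul]
  refine integral_congr_ae ?_
  filter_upwards [A.prop_dominates n x] with y hy
  have ha : (A.adj n x : ℝ) ≠ 0 := NNReal.coe_ne_zero.2 (A.adj_pos n x).ne'
  by_cases h0 : A.prop n x y = 0
  · simp [h0, hy h0]
  · have h1 : (A.prop n x y : ℝ) ≠ 0 := NNReal.coe_ne_zero.2 h0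
    simp only [weightFun, NNReal.coe_div, NNReal.coe_mul, NNReal.coe_pow]
    field_simp

theorem measurable_initWeight : Measurable A.initWeight :=
  M.measurable_chi.div A.measurable_nu

theorem measurable_weightFun (n : ℕ) (r : Bool) :
    Measurable (Function.uncurry (A.weightFun n r)) :=
  (M.measurable_ell n).div
    ((((A.measurable_adj n).comp measurable_fst).pow_const _).mul (A.measurable_prop n))

end ApfParams

/-! ### Conditional means of one iteration. -/

namespace AdaSmooth

variable {X : ℕ → Type*} [∀ n, MeasurableSpace (X n)] {M : PathModel X} {N : ℕ}

/-- The weighted empirical mean `N⁻¹ ∑ i, w i (t i f(x i) + g(x i))`. -/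
noncomputable def empMean {E : Type*} (x : Fin N → E) (w : Fin N → ℝ≥0) (t : Fin N → ℝ)
    (f g : E → ℝ) : ℝ :=
  (N : ℝ)⁻¹ * ∑ i, (w i : ℝ) * (t i * f (x i) + g (x i))

/-- The updated statistic, paired with the test functions `f` and `g`, of a particle at `y` with
ancestor index `l` and backward index `j`. -/
noncomputable def statTerm (h : AdditiveTerms X) (n : ℕ) (e : Bool) (f g : X (n + 1) → ℝ)
    (x : Fin N → X n) (t : Fin N → ℝ) (l : Fin N) (y : X (n + 1)) (j : Fin N) : ℝ :=
  (if e = true then 2⁻¹ * (t l + h.incr n (x l) y + t j + h.incr n (x j) y)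
    else t l + h.incr n (x l) y) * f y + g y

/-- The average of `statTerm` over the backward index. -/
noncomputable def statMean (M : PathModel X) (h : AdditiveTerms X) (n : ℕ) (e : Bool)
    (f g : X (n + 1) → ℝ) (x : Fin N → X n) (w : Fin N → ℝ≥0) (t : Fin N → ℝ) (l : Fin N)
    (y : X (n + 1)) : ℝ :=
  ∫ j, statTerm h n e f g x t l y j ∂(backwardLaw M n x w y)

/-- The updated weight of the `i`-th particle when it is at `y` and has ancestor index `l`. -/
noncomputable def weightTerm (A : ApfParams M) (n : ℕ) (r : Bool) (x : Fin N → X n)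
    (w : Fin N → ℝ≥0) (i l : Fin N) (y : X (n + 1)) : ℝ≥0 :=
  A.weightFun n r (x l) y * (if r = true then 1 else w i)

/-- The average over the position of the `i`-th particle of its weighted statistic, given its
ancestor index `l`. -/
noncomputable def mutationMean (A : ApfParams M) (h : AdditiveTerms X) (n : ℕ) (r e : Bool)
    (f g : X (n + 1) → ℝ) (x : Fin N → X n) (w : Fin N → ℝ≥0) (t : Fin N → ℝ) (i l : Fin N) : ℝ :=
  ∫ y, (weightTerm A n r x w i l y : ℝ) * statMean M h n e f g x w t l y ∂(A.propLaw n (x l))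

/-- The average over all random choices of the weighted statistic of the `i`-th particle. -/
noncomputable def selectionMean (A : ApfParams M) (h : AdditiveTerms X) (n : ℕ) (r e : Bool)
    (f g : X (n + 1) → ℝ) (x : Fin N → X n) (w : Fin N → ℝ≥0) (t : Fin N → ℝ) (i : Fin N) : ℝ :=
  ∫ l, mutationMean A h n r e f g x w t i l ∂(ancestorLaw A n r x w i)

theorem isProbabilityMeasure_ancestorLaw (hN : 1 ≤ N) (A : ApfParams M) (n : ℕ) (r : Bool)
    (x : Fin N → X n) (w : Fin N → ℝ≥0) (i : Fin N) :
    IsProbabilityMeasure (ancestorLaw A n r x w i) := by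
  unfold ancestorLaw
  split_ifs
  · exact isProbabilityMeasure_cat hN _
  · infer_instance

theorem isProbabilityMeasure_backwardLaw (hN : 1 ≤ N) (n : ℕ) (x : Fin N → X n)
    (w : Fin N → ℝ≥0) (y : X (n + 1)) : IsProbabilityMeasure (backwardLaw M n x w y) :=
  isProbabilityMeasure_cat hN _

section Bounds

variable {h : AdditiveTerms X} {n : ℕ} {e : Bool} {f g : X (n + 1) → ℝ} {x : Fin N → X n}
  {t : Fin N → ℝ} {Ct Ch Cf Cg : ℝ}

theorem abs_statTerm_le (ht : ∀ i, |t i| ≤ Ct) (hh : ∀ x y, |h.incr n x y| ≤ Ch)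
    (hf : ∀ y, |f y| ≤ Cf) (hg : ∀ y, |g y| ≤ Cg) (l : Fin N) (y : X (n + 1)) (j : Fin N) :
    |statTerm h n e f g x t l y j| ≤ (Ct + Ch) * Cf + Cg := by
  have key : |if e = true then 2⁻¹ * (t l + h.incr n (x l) y + t j + h.incr n (x j) y)
      else t l + h.incr n (x l) y| ≤ Ct + Ch := by
    have h1 := abs_le.1 (ht l)
    have h2 := abs_le.1 (ht j)
    have h3 := abs_le.1 (hh (x l) y)
    have h4 := abs_le.1 (hh (x j) y)
    split_ifs <;> exact abs_le.2 ⟨by linarith, by linarith⟩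
  refine (abs_add_le _ _).trans (add_le_add ?_ (hg y))
  rw [abs_mul]
  exact mul_le_mul key (hf y) (abs_nonneg _) ((abs_nonneg _).trans key)

end Bounds

section Measurability

variable {α : Type*} {mα : MeasurableSpace α} {n : ℕ} {x : α → Fin N → X n} {w : α → Fin N → ℝ≥0}
  {t : α → Fin N → ℝ} {l j : α → Fin N} {y : α → X (n + 1)} {f g : X (n + 1) → ℝ}

theorem measurable_statTerm (h : AdditiveTerms X) (e : Bool) (hf : Measurable f)
    (hg : Measurable g) (hx : Measurable x) (ht : Measurable t) (hl : Measurable l)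
    (hy : Measurable y) (hj : Measurable j) :
    Measurable fun a => statTerm h n e f g (x a) (t a) (l a) (y a) (j a) := by
  have h1 : Measurable fun a => h.incr n (x a (l a)) (y a) :=
    (h.measurable_incr n).comp ((hx.eval_index hl).prodMk hy)
  have h2 : Measurable fun a => h.incr n (x a (j a)) (y a) :=
    (h.measurable_incr n).comp ((hx.eval_index hj).prodMk hy)
  have h3 := ht.eval_index hl
  have h4 := ht.eval_index hj
  unfold statTerm
  refine Measurable.add (Measurable.mul ?_ (hf.comp hy)) (hg.comp hy)
  split_ifs
  · exact measurable_const.mul (((h3.add h1).add h4).add h2)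
  · exact h3.add h1

theorem measurable_statMean (M : PathModel X) (h : AdditiveTerms X) (e : Bool) (hf : Measurable f)
    (hg : Measurable g) (hx : Measurable x) (hw : Measurable w) (ht : Measurable t)
    (hl : Measurable l) (hy : Measurable y) :
    Measurable fun a => statMean M h n e f g (x a) (w a) (t a) (l a) (y a) := by
  unfold statMean backwardLaw
  simp only [integral_cat]
  refine Finset.measurable_sum _ fun j _ => Measurable.mul ?_
    (measurable_statTerm h e hf hg hx ht hl hy measurable_const)
  refine (measurable_catProb j).comp (measurable_pi_iff.2 fun k => ?_)
  exact ((measurable_pi_apply k).comp hw).mul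
    ((M.measurable_ell n).comp (((measurable_pi_apply k).comp hx).prodMk hy))

theorem measurable_weightTerm (A : ApfParams M) (r : Bool) (i : Fin N) (hx : Measurable x)
    (hw : Measurable w) (hl : Measurable l) (hy : Measurable y) :
    Measurable fun a => weightTerm A n r (x a) (w a) i (l a) (y a) := by
  unfold weightTerm
  refine ((A.measurable_weightFun n r).comp ((hx.eval_index hl).prodMk hy)).mul ?_
  split_ifs
  · exact measurable_const
  · exact (measurable_pi_apply i).comp hw

theorem measurable_mutationMean (A : ApfParams M) (h : AdditiveTerms X) (r e : Bool)
    (hf : Measurable f) (hg : Measurable g) (i : Fin N) (hx : Measurable x) (hw : Measurable w)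
    (ht : Measurable t) :
    Measurable fun p : α × Fin N =>
      mutationMean A h n r e f g (x p.1) (w p.1) (t p.1) i p.2 := by
  refine measurable_from_prod_countable_left fun l => ?_
  unfold mutationMean
  simp only [ApfParams.integral_propLaw]
  have hx' : Measurable fun p : α × X (n + 1) => x p.1 := hx.comp measurable_fst
  have hw' : Measurable fun p : α × X (n + 1) => w p.1 := hw.comp measurable_fst
  have ht' : Measurable fun p : α × X (n + 1) => t p.1 := ht.comp measurable_fst
  have hl' : Measurable fun _ : α × X (n + 1) => l := measurable_const
  refine (StronglyMeasurable.integral_prod_right (ν := M.mu (n + 1)) (f := fun a y =>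
    (A.prop n (x a l) y : ℝ) * ((weightTerm A n r (x a) (w a) i l y : ℝ) *
      statMean M h n e f g (x a) (w a) (t a) l y)) ?_).measurable
  refine Measurable.stronglyMeasurable ?_
  exact ((A.measurable_prop n).comp
    ((hx'.eval_index hl').prodMk measurable_snd)).coe_nnreal_real.mul
      ((measurable_weightTerm A r i hx' hw' hl' measurable_snd).coe_nnreal_real.mul
      (measurable_statMean M h e hf hg hx' hw' ht' hl' measurable_snd))

end Measurability

section Identities

variable (A : ApfParams M) (h : AdditiveTerms X) {n : ℕ} {f g : X (n + 1) → ℝ}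
  (x : Fin N → X n) (w : Fin N → ℝ≥0) (t : Fin N → ℝ)

/-- With `a l = w l * ell (x l) y`, the backward probabilities are `a j / ∑ a`. Replacing each term
`b l` by half of itself plus half of the `a`-weighted mean of `b` does not change `∑ a l * b l`. -/
theorem sum_mul_statMean (e : Bool) (y : X (n + 1)) :
    ∑ l, ((w l * M.ell n (x l) y : ℝ≥0) : ℝ) * statMean M h n e f g x w t l y =
      ∑ l, ((w l * M.ell n (x l) y : ℝ≥0) : ℝ) * ((t l + h.incr n (x l) y) * f y + g y) := by
  unfold statMean backwardLaw
  simp only [integral_cat]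
  set a : Fin N → ℝ≥0 := fun l => w l * M.ell n (x l) y with ha
  -- When all weights vanish both sides are zero, so the uniform convention in `cat` is harmless.
  by_cases h0 : ∑ k, a k = 0
  · have h1 : ∀ l, a l = 0 := fun l => (Finset.sum_eq_zero_iff.1 h0) l (Finset.mem_univ l)
    simp only [ha] at h1
    simp [h1]
  have hs : (∑ k, (a k : ℝ)) ≠ 0 := by rw [← NNReal.coe_sum]; exact NNReal.coe_ne_zero.2 h0
  have hp : ∀ j, catProb a j = (a j : ℝ) / ∑ k, (a k : ℝ) := fun j => by
    rw [catProb, if_neg h0, NNReal.coe_div, NNReal.coe_sum]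
  have hp1 : ∑ j, catProb a j = 1 := by
    simp only [hp]
    rw [← Finset.sum_div, div_self hs]
  let b : Fin N → ℝ := fun l => (t l + h.incr n (x l) y) * f y + g y
  by_cases he : e = true
  · have h2 : ∀ l, ∑ j, catProb a j * statTerm h n e f g x t l y j =
        2⁻¹ * b l + 2⁻¹ * ∑ j, catProb a j * b j := by
      intro l
      have : ∀ j, catProb a j * statTerm h n e f g x t l y j =
          catProb a j * (2⁻¹ * b l) + 2⁻¹ * (catProb a j * b j) := by
        intro j
        simp only [statTerm, he, if_true, b]
        ring
      simp only [this]
      rw [Finset.sum_add_distrib, ← Finset.sum_mul, hp1, one_mul, Finset.mul_sum]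
    simp only [h2, mul_add, Finset.sum_add_distrib]
    rw [← Finset.sum_mul]
    have h3 : ∑ l, (a l : ℝ) * (2⁻¹ * b l) = 2⁻¹ * ∑ l, (a l : ℝ) * b l := by
      rw [Finset.mul_sum]; exact Finset.sum_congr rfl fun l _ => by ring
    have h4 : ∑ j, catProb a j * b j = (∑ l, (a l : ℝ) * b l) / ∑ k, (a k : ℝ) := by
      simp only [hp]
      rw [Finset.sum_div]; exact Finset.sum_congr rfl fun l _ => by ring
    have h5 : ∑ l, (a l : ℝ) * b l = ∑ l, (a l : ℝ) * ((t l + h.incr n (x l) y) * f y) +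
        ∑ l, (a l : ℝ) * g y := by
      rw [← Finset.sum_add_distrib]; exact Finset.sum_congr rfl fun l _ => mul_add _ _ _
    rw [h3, h4, ← h5]
    field_simp
    ring
  · simp only [statTerm, he, if_false, Bool.false_eq_true]
    simp only [← Finset.sum_mul, hp1, one_mul]

theorem mutationMean_eq (r e : Bool) (i l : Fin N) :
    mutationMean A h n r e f g x w t i l =
      (if r = true then 1 else (w i : ℝ)) * (((A.adj n (x l) : ℝ) ^ r.toNat)⁻¹ *
        M.trans n (fun _ y => statMean M h n e f g x w t l y) (x l)) := by
  rw [← A.integral_weightFun_propLaw, ← integral_const_mul, mutationMean]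
  refine integral_congr_ae (Eventually.of_forall fun y => ?_)
  simp only [weightTerm]
  split_ifs <;> push_cast <;> ring

theorem trans_affine (hf : BoundedMeasurable f) (hg : BoundedMeasurable g) (z : X n) (c : ℝ) :
    M.trans n (fun x y => (c + h.incr n x y) * f y + g y) z =
      c * M.trans n (fun _ y => f y) z + M.trans n (fun x y => h.incr n x y * f y + g y) z := by
  have i1 : Integrable (fun y => (M.ell n z y : ℝ) * f y) (M.mu (n + 1)) :=
    hf.integrable_mul (M.integrable_ell n z)
  have i2 : Integrable (fun y => (M.ell n z y : ℝ) * (h.incr n z y * f y + g y))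
      (M.mu (n + 1)) :=
    BoundedMeasurable.integrable_mul ((((h.boundedMeasurable_incr n).comp
      (u := fun y => (z, y)) measurable_prodMk_left).mul hf).add hg) (M.integrable_ell n z)
  unfold PathModel.trans
  rw [← integral_const_mul, ← integral_add (i1.const_mul _) i2]
  exact integral_congr_ae (Eventually.of_forall fun y => by ring)

/-- The identity `sum_mul_statMean` holds for every `y`; it is integrated after exchanging the
finite sum over particles with the integral. -/
theorem sum_mul_trans_statMean (hN : 1 ≤ N) (e : Bool) (hf : BoundedMeasurable f)
    (hg : BoundedMeasurable g) :
    ∑ l, (w l : ℝ) * M.trans n (fun _ y => statMean M h n e f g x w t l y) (x l) =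
      ∑ l, (w l : ℝ) * (t l * M.trans n (fun _ y => f y) (x l) +
        M.trans n (fun x y => h.incr n x y * f y + g y) (x l)) := by
  obtain ⟨Cf, hCf⟩ := hf.bounded
  obtain ⟨Cg, hCg⟩ := hg.bounded
  obtain ⟨Ch, hCh⟩ := h.bounded_incr n
  -- Here `N` is fixed and only integrability is at stake, so a bound depending on `N` is enough.
  have ht : ∀ i, |t i| ≤ ∑ k, |t k| := fun i =>
    Finset.single_le_sum (f := fun k => |t k|) (fun _ _ => abs_nonneg _) (Finset.mem_univ i)
  have hbm : ∀ l, BoundedMeasurable fun y => statMean M h n e f g x w t l y := fun l =>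
    ⟨measurable_statMean M h e hf.measurable hg.measurable measurable_const measurable_const
      measurable_const measurable_const measurable_id, _, fun y =>
      have := isProbabilityMeasure_backwardLaw (M := M) hN n x w y
      abs_integral_le_of_abs_le _ (abs_statTerm_le ht hCh hCf hCg l y)⟩
  have hbm' : ∀ l, BoundedMeasurable fun y => (t l + h.incr n (x l) y) * f y + g y := fun l =>
    (((BoundedMeasurable.const (t l)).add ((h.boundedMeasurable_incr n).comp
      (u := fun y => (x l, y)) measurable_prodMk_left)).mul hf).add hg
  simp only [← trans_affine h hf hg]
  unfold PathModel.trans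
  simp only [← integral_const_mul]
  rw [← integral_finsetSum _ fun l _ =>
      ((hbm l).integrable_mul (M.integrable_ell n (x l))).const_mul _,
    ← integral_finsetSum _ fun l _ =>
      ((hbm' l).integrable_mul (M.integrable_ell n (x l))).const_mul _]
  refine integral_congr_ae (Eventually.of_forall fun y => ?_)
  have key := sum_mul_statMean (M := M) h (f := f) (g := g) x w t e y
  simpa only [NNReal.coe_mul, mul_assoc] using key

theorem statMean_false (hN : 1 ≤ N) (l : Fin N) (y : X (n + 1)) :
    statMean M h n false f g x w t l y = (t l + h.incr n (x l) y) * f y + g y := by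
  have := isProbabilityMeasure_backwardLaw (M := M) hN n x w y
  simp [statMean, statTerm]

/-- Each particle is its own ancestor and keeps its old weight as a factor, so the two sums agree
term by term. -/
theorem mean_selectionMean_false (hN : 1 ≤ N) (hf : BoundedMeasurable f)
    (hg : BoundedMeasurable g) :
    (N : ℝ)⁻¹ * ∑ i, selectionMean A h n false false f g x w t i =
      empMean x w t (M.trans n fun _ y => f y)
        (M.trans n fun x y => h.incr n x y * f y + g y) := by
  rw [empMean]
  congr 1
  refine Finset.sum_congr rfl fun i _ => ?_
  rw [selectionMean, ancestorLaw, if_neg Bool.false_ne_true, integral_dirac, mutationMean_eq,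
    ← trans_affine h hf hg]
  simp only [statMean_false h x w t hN, Bool.false_eq_true, if_false, Bool.toNat_false, pow_zero,
    inv_one, one_mul]
  rfl

/-- The selection probability is proportional to `w l * adj (x l)`, and its multiplier cancels the
inverse one in the importance weight. The remaining sum does not depend on `i` and is computed by
`sum_mul_trans_statMean`. -/
theorem mean_selectionMean_true (hN : 1 ≤ N) (e : Bool) (hf : BoundedMeasurable f)
    (hg : BoundedMeasurable g)
    (h0 : empMean x w t (fun _ => 0) (fun z => (A.adj n z : ℝ)) ≠ 0) :
    (N : ℝ)⁻¹ * ∑ i, selectionMean A h n true e f g x w t i =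
      empMean x w t (M.trans n fun _ y => f y)
        (M.trans n fun x y => h.incr n x y * f y + g y) /
      empMean x w t (fun _ => 0) (fun z => (A.adj n z : ℝ)) := by
  have hN0 : (N : ℝ) ≠ 0 := by exact_mod_cast (by omega : N ≠ 0)
  simp only [empMean, mul_zero, zero_add] at h0 ⊢
  have hs : ∑ k, (w k : ℝ) * (A.adj n (x k) : ℝ) ≠ 0 := fun h => h0 (by rw [h, mul_zero])
  have hs' : ∑ k, w k * A.adj n (x k) ≠ 0 := fun h => hs (by
    have := congrArg NNReal.toReal h
    push_cast at this
    exact this)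
  have key : ∀ i, selectionMean A h n true e f g x w t i =
      (∑ l, (w l : ℝ) * (t l * M.trans n (fun _ y => f y) (x l) +
        M.trans n (fun x y => h.incr n x y * f y + g y) (x l))) /
      ∑ k, (w k : ℝ) * (A.adj n (x k) : ℝ) := by
    intro i
    rw [selectionMean, ancestorLaw, if_pos rfl, integral_cat,
      ← sum_mul_trans_statMean h x w t hN e hf hg, Finset.sum_div]
    refine Finset.sum_congr rfl fun l _ => ?_
    have ha : (A.adj n (x l) : ℝ) ≠ 0 := NNReal.coe_ne_zero.2 (A.adj_pos n _).ne'
    rw [mutationMean_eq, catProb, if_neg hs']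
    simp only [if_true, Bool.toNat_true, pow_one, one_mul]
    push_cast
    field_simp
  simp only [key, Finset.sum_const, Finset.card_univ, Fintype.card_fin, nsmul_eq_mul]
  field_simp

end Identities

end AdaSmooth

/-! ### Weights and statistics along a run: uniform bounds and measurability. -/

namespace AdaSmooth

variable {X : ℕ → Type*} [∀ n, MeasurableSpace (X n)] {M : PathModel X} {N : ℕ}

theorem weight_succ (A : ApfParams M) (ρ : ℕ → Bool) (ξ : ∀ n, Fin N → X n)
    (I : ℕ → Fin N → Fin N) (n : ℕ) (i : Fin N) :
    weight A ρ ξ I (n + 1) i =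
      weightTerm A n (ρ n) (ξ n) (weight A ρ ξ I n) i (I (n + 1) i) (ξ (n + 1) i) := rfl

theorem stat_succ_mul_add (h : AdditiveTerms X) (ε : ℕ → Bool) (ξ : ∀ n, Fin N → X n)
    (I J : ℕ → Fin N → Fin N) (n : ℕ) (i : Fin N) (f g : X (n + 1) → ℝ) :
    stat h ε ξ I J (n + 1) i * f (ξ (n + 1) i) + g (ξ (n + 1) i) =
      statTerm h n (ε n) f g (ξ n) (stat h ε ξ I J n) (I (n + 1) i) (ξ (n + 1) i)
        (J (n + 1) i) := rfl

theorem stat_succ (h : AdditiveTerms X) (ε : ℕ → Bool) (ξ : ∀ n, Fin N → X n)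
    (I J : ℕ → Fin N → Fin N) (n : ℕ) (i : Fin N) :
    stat h ε ξ I J (n + 1) i = statTerm h n (ε n) (fun _ => 1) (fun _ => 0) (ξ n)
      (stat h ε ξ I J n) (I (n + 1) i) (ξ (n + 1) i) (J (n + 1) i) := by
  rw [← stat_succ_mul_add, mul_one, add_zero]

/-- The bound must not depend on `N`, so that the Hoeffding bounds are summable over `N`. -/
theorem exists_weight_le {A : ApfParams M} (hA : A.BoundedWeights) (ρ : ℕ → Bool) (n : ℕ) :
    ∃ C : ℝ≥0, ∀ (N : ℕ) (ξ : ∀ n, Fin N → X n) (I : ℕ → Fin N → Fin N) (i : Fin N),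
      weight A ρ ξ I n i ≤ C := by
  induction n with
  | zero => exact hA.1.imp fun C hC N ξ I i => hC _
  | succ n ih =>
    obtain ⟨C, hC⟩ := ih
    obtain ⟨D, hD⟩ := hA.2.1 ρ n
    refine ⟨D * max 1 C, fun N ξ I i => mul_le_mul (hD _ _) ?_ zero_le zero_le⟩
    split_ifs
    · exact le_max_left _ _
    · exact (hC N ξ I i).trans (le_max_right _ _)

theorem exists_abs_stat_le (h : AdditiveTerms X) (ε : ℕ → Bool) (n : ℕ) :
    ∃ C : ℝ, ∀ (N : ℕ) (ξ : ∀ n, Fin N → X n) (I J : ℕ → Fin N → Fin N) (i : Fin N),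
      |stat h ε ξ I J n i| ≤ C := by
  induction n with
  | zero => exact h.bounded_init.imp fun C hC N ξ I J i => hC _
  | succ n ih =>
    obtain ⟨C, hC⟩ := ih
    obtain ⟨D, hD⟩ := h.bounded_incr n
    -- The factor 1 and the summand 0 bound the test functions `f = 1` and `g = 0` of `stat_succ`.
    refine ⟨(C + D) * 1 + 0, fun N ξ I J i => ?_⟩
    rw [stat_succ]
    exact abs_statTerm_le (hC N ξ I J) hD (fun _ => by simp) (fun _ => by simp) _ _ _

section Measurability

variable {α : Type*} {mα : MeasurableSpace α} {ξ : ∀ n, α → Fin N → X n}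
  {I J : ℕ → α → Fin N → Fin N}

/-- Measurability is required only up to time `n`, so that the lemma applies with the history at
time `n` as σ-field. -/
theorem measurable_weight (A : ApfParams M) (ρ : ℕ → Bool) (n : ℕ)
    (hξ : ∀ k ≤ n, Measurable (ξ k)) (hI : ∀ k < n, Measurable (I (k + 1))) :
    Measurable fun a => weight A ρ (fun k => ξ k a) (fun k => I k a) n := by
  refine measurable_pi_iff.2 fun i => ?_
  induction n generalizing i with
  | zero => exact A.measurable_initWeight.comp ((measurable_pi_apply i).comp (hξ 0 le_rfl))
  | succ n ih =>
    simp only [weight_succ]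
    exact measurable_weightTerm A (ρ n) i (hξ n n.le_succ)
      (measurable_pi_iff.2 (ih (fun k hk => hξ k (hk.trans n.le_succ))
        fun k hk => hI k (hk.trans n.lt_succ_self)))
      ((measurable_pi_apply i).comp (hI n n.lt_succ_self))
      ((measurable_pi_apply i).comp (hξ (n + 1) le_rfl))

theorem measurable_stat (h : AdditiveTerms X) (ε : ℕ → Bool) (n : ℕ)
    (hξ : ∀ k, Measurable (ξ k)) (hI : ∀ k, Measurable (I (k + 1)))
    (hJ : ∀ k, ε k = true → Measurable (J (k + 1))) :
    Measurable fun a => stat h ε (fun k => ξ k a) (fun k => I k a) (fun k => J k a) n := by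
  refine measurable_pi_iff.2 fun i => ?_
  induction n generalizing i with
  | zero => exact h.measurable_init.comp ((measurable_pi_apply i).comp (hξ 0))
  | succ n ih =>
    have hi : Measurable fun a => I (n + 1) a i := (measurable_pi_apply i).comp (hI n)
    have hy : Measurable fun a => ξ (n + 1) a i := (measurable_pi_apply i).comp (hξ (n + 1))
    simp only [stat_succ]
    by_cases he : ε n = true
    · exact measurable_statTerm h (ε n) measurable_const measurable_const (hξ n)
        (measurable_pi_iff.2 ih) hi hy ((measurable_pi_apply i).comp (hJ n he))
    -- Without backward sampling `J (n + 1)` need not be measurable; as the term ignores it, the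
    -- constant index `i` takes its place.
    · have : ∀ a j, statTerm h n (ε n) (fun _ => 1) (fun _ => 0) (ξ n a)
          (stat h ε (fun k => ξ k a) (fun k => I k a) (fun k => J k a) n) (I (n + 1) a i)
          (ξ (n + 1) a i) j = statTerm h n (ε n) (fun _ => 1) (fun _ => 0) (ξ n a)
          (stat h ε (fun k => ξ k a) (fun k => I k a) (fun k => J k a) n) (I (n + 1) a i)
          (ξ (n + 1) a i) i := fun a j => by simp only [statTerm, if_neg he]
      simp only [this]
      exact measurable_statTerm h (ε n) measurable_const measurable_const (hξ n)
        (measurable_pi_iff.2 ih) hi hy measurable_const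

variable (h : AdditiveTerms X) (ε : ℕ → Bool)

theorem history_mono : Monotone (history h ε ξ I J) :=
  monotone_nat_of_le_succ fun _ => le_sup_left.trans (le_sup_left.trans le_sup_left)

theorem measurable_particle_history {k n : ℕ} (hk : k ≤ n) :
    Measurable[history h ε ξ I J n] (ξ k) := by
  refine Measurable.mono (measurable_iff_comap_le.2 ?_) (history_mono h ε hk) le_rfl
  cases k with
  | zero => exact le_rfl
  | succ k => exact le_sup_right.trans le_sup_left

theorem measurable_ancestor_history {k n : ℕ} (hk : k < n) :
    Measurable[history h ε ξ I J n] (I (k + 1)) :=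
  Measurable.mono (measurable_iff_comap_le.2
    (le_sup_right.trans (le_sup_left.trans le_sup_left))) (history_mono h ε hk) le_rfl

theorem measurable_weight_history (A : ApfParams M) (ρ : ℕ → Bool) (n : ℕ) :
    Measurable[history h ε ξ I J n]
      fun a => weight A ρ (fun k => ξ k a) (fun k => I k a) n :=
  measurable_weight A ρ n (fun _ hk => measurable_particle_history h ε hk)
    fun _ hk => measurable_ancestor_history h ε hk

/-- Backward indices are not generators of the history, so the recursion is of no help: at positive
times the statistic is itself a generator, and at time 0 it is a function of the initial particles.
-/
theorem measurable_stat_history (n : ℕ) :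
    Measurable[history h ε ξ I J n]
      fun a => stat h ε (fun k => ξ k a) (fun k => I k a) (fun k => J k a) n := by
  cases n with
  | zero =>
    have h0 : Measurable fun (x : Fin N → X 0) i => h.init (x i) :=
      measurable_pi_iff.2 fun i => h.measurable_init.comp (measurable_pi_apply i)
    exact h0.comp (comap_measurable (ξ 0))
  | succ n => exact measurable_iff_comap_le.2 le_sup_right

theorem history_le (n : ℕ) (hξ : ∀ k, Measurable (ξ k)) (hI : ∀ k, Measurable (I (k + 1)))
    (hJ : ∀ k, ε k = true → Measurable (J (k + 1))) : history h ε ξ I J n ≤ mα := by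
  induction n with
  | zero => exact (hξ 0).comap_le
  | succ n ih =>
    exact sup_le (sup_le (sup_le ih (hI n).comap_le) (hξ (n + 1)).comap_le)
      (measurable_stat h ε (n + 1) hξ hI hJ).comap_le

end Measurability

/-- The σ-field generated by the first `n` iterations and by the ancestor indices of the next. -/
noncomputable abbrev selectionHistory {Ω : Type*} (h : AdditiveTerms X) (ε : ℕ → Bool)
    (ξ : ∀ n, Ω → Fin N → X n) (I J : ℕ → Ω → Fin N → Fin N) (n : ℕ) : MeasurableSpace Ω :=
  history h ε ξ I J n ⊔ MeasurableSpace.comap (I (n + 1)) inferInstance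

/-- The σ-field generated by the first `n` iterations and by the ancestor indices and the
particles of the next. -/
noncomputable abbrev mutationHistory {Ω : Type*} (h : AdditiveTerms X) (ε : ℕ → Bool)
    (ξ : ∀ n, Ω → Fin N → X n) (I J : ℕ → Ω → Fin N → Fin N) (n : ℕ) : MeasurableSpace Ω :=
  selectionHistory h ε ξ I J n ⊔ MeasurableSpace.comap (ξ (n + 1)) inferInstance

/-! ### Deviation bounds for the random choices of one iteration and for the initial draw. -/

section Deviations

variable {Ω : Type*} [MeasurableSpace Ω] {P : Measure Ω} [IsProbabilityMeasure P]
  {A : ApfParams M} {h : AdditiveTerms X} {ρ ε : ℕ → Bool} {ξ : ∀ n, Ω → Fin N → X n}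
  {I J : ℕ → Ω → Fin N → Fin N} {n : ℕ} {f g : X (n + 1) → ℝ} {C δ : ℝ}

theorem IsRun.measure_backward_deviation_le (hrun : IsRun P A h ρ ε ξ I J) (hN : 1 ≤ N)
    (hf : Measurable f) (hg : Measurable g) (hC : 0 < C)
    (hbound : ∀ ω i l y j, |(weightTerm A n (ρ n) (ξ n ω)
      (weight A ρ (fun k => ξ k ω) (fun k => I k ω) n) i l y : ℝ) *
      statTerm h n (ε n) f g (ξ n ω)
        (stat h ε (fun k => ξ k ω) (fun k => I k ω) (fun k => J k ω) n) l y j| ≤ C)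
    (hδ : 0 < δ) :
    P {ω | δ ≤ |(N : ℝ)⁻¹ * ∑ i, ((weightTerm A n (ρ n) (ξ n ω)
      (weight A ρ (fun k => ξ k ω) (fun k => I k ω) n) i (I (n + 1) ω i) (ξ (n + 1) ω i) : ℝ) *
      statTerm h n (ε n) f g (ξ n ω)
        (stat h ε (fun k => ξ k ω) (fun k => I k ω) (fun k => J k ω) n)
        (I (n + 1) ω i) (ξ (n + 1) ω i) (J (n + 1) ω i) -
      (weightTerm A n (ρ n) (ξ n ω)
      (weight A ρ (fun k => ξ k ω) (fun k => I k ω) n) i (I (n + 1) ω i) (ξ (n + 1) ω i) : ℝ) *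
      statMean M h n (ε n) f g (ξ n ω) (weight A ρ (fun k => ξ k ω) (fun k => I k ω) n)
        (stat h ε (fun k => ξ k ω) (fun k => I k ω) (fun k => J k ω) n)
        (I (n + 1) ω i) (ξ (n + 1) ω i))|} ≤
      ENNReal.ofReal (2 * Real.exp (-(δ ^ 2 / (2 * C ^ 2)) * N)) := by
  by_cases he : ε n = true
  · have hle := history_le h ε n hrun.measurable_particle hrun.measurable_ancestor
      hrun.measurable_backward
    have hle' : mutationHistory h ε ξ I J n ≤ ‹MeasurableSpace Ω› :=
      sup_le (sup_le hle (hrun.measurable_ancestor n).comap_le)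
        (hrun.measurable_particle (n + 1)).comap_le
    have hsub : history h ε ξ I J n ≤ mutationHistory h ε ξ I J n := le_sup_left.trans le_sup_left
    have hx : Measurable[mutationHistory h ε ξ I J n] (ξ n) := (measurable_particle_history h ε le_rfl).mono hsub le_rfl
    have hw := (measurable_weight_history (ξ := ξ) (I := I) (J := J) h ε A ρ n).mono hsub le_rfl
    have ht := (measurable_stat_history (ξ := ξ) (I := I) (J := J) h ε n).mono hsub le_rfl
    have hI : Measurable[mutationHistory h ε ξ I J n] (I (n + 1)) := measurable_iff_comap_le.2 (le_sup_right.trans le_sup_left)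
    have hy : Measurable[mutationHistory h ε ξ I J n] (ξ (n + 1)) := measurable_iff_comap_le.2 le_sup_right
    have := fun ω i => isProbabilityMeasure_backwardLaw (M := M) hN n (ξ n ω)
      (weight A ρ (fun k => ξ k ω) (fun k => I k ω) n) (ξ (n + 1) ω i)
    have key := (hrun.backward n he).measure_deviation_le hN hle' (hrun.measurable_backward n he)
      (g := fun i ω j => (weightTerm A n (ρ n) (ξ n ω)
        (weight A ρ (fun k => ξ k ω) (fun k => I k ω) n) i (I (n + 1) ω i)
          (ξ (n + 1) ω i) : ℝ) *
        statTerm h n (ε n) f g (ξ n ω)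
          (stat h ε (fun k => ξ k ω) (fun k => I k ω) (fun k => J k ω) n)
          (I (n + 1) ω i) (ξ (n + 1) ω i) j) (fun i => ?_) hC (fun i ω j => hbound ω i _ _ j) hδ
    · simpa only [integral_const_mul, statMean] using key
    · have hfst : Measurable[(mutationHistory h ε ξ I J n).prod inferInstance,
          mutationHistory h ε ξ I J n] (Prod.fst : Ω × Fin N → Ω) := measurable_fst
      have hIi := ((measurable_pi_apply i).comp hI).comp hfst
      have hyi := ((measurable_pi_apply i).comp hy).comp hfst
      exact (measurable_weightTerm A (ρ n) i (hx.comp measurable_fst) (hw.comp measurable_fst)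
        hIi hyi).coe_nnreal_real.mul (measurable_statTerm h (ε n) hf hg
          (hx.comp measurable_fst) (ht.comp measurable_fst) hIi hyi measurable_snd)
  -- Without backward sampling `statTerm` equals its mean, so the deviation is identically zero.
  · rw [Bool.not_eq_true] at he
    simp only [he, statMean_false h _ _ _ hN, statTerm, Bool.false_eq_true, if_false, sub_self,
      Finset.sum_const_zero, mul_zero, abs_zero, hδ.not_ge]
    simp

theorem IsRun.measure_mutation_deviation_le (hrun : IsRun P A h ρ ε ξ I J) (hN : 1 ≤ N)
    (hf : Measurable f) (hg : Measurable g) (hC : 0 < C)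
    (hbound : ∀ ω i l y, |(weightTerm A n (ρ n) (ξ n ω)
      (weight A ρ (fun k => ξ k ω) (fun k => I k ω) n) i l y : ℝ) *
      statMean M h n (ε n) f g (ξ n ω) (weight A ρ (fun k => ξ k ω) (fun k => I k ω) n)
        (stat h ε (fun k => ξ k ω) (fun k => I k ω) (fun k => J k ω) n) l y| ≤ C)
    (hδ : 0 < δ) :
    P {ω | δ ≤ |(N : ℝ)⁻¹ * ∑ i, ((weightTerm A n (ρ n) (ξ n ω)
      (weight A ρ (fun k => ξ k ω) (fun k => I k ω) n) i (I (n + 1) ω i) (ξ (n + 1) ω i) : ℝ) *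
      statMean M h n (ε n) f g (ξ n ω) (weight A ρ (fun k => ξ k ω) (fun k => I k ω) n)
        (stat h ε (fun k => ξ k ω) (fun k => I k ω) (fun k => J k ω) n)
        (I (n + 1) ω i) (ξ (n + 1) ω i) -
      mutationMean A h n (ρ n) (ε n) f g (ξ n ω)
        (weight A ρ (fun k => ξ k ω) (fun k => I k ω) n)
        (stat h ε (fun k => ξ k ω) (fun k => I k ω) (fun k => J k ω) n)
        i (I (n + 1) ω i))|} ≤
      ENNReal.ofReal (2 * Real.exp (-(δ ^ 2 / (2 * C ^ 2)) * N)) := by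
  have hle := history_le h ε n hrun.measurable_particle hrun.measurable_ancestor
    hrun.measurable_backward
  have hle' : selectionHistory h ε ξ I J n ≤ ‹MeasurableSpace Ω› :=
    sup_le hle (hrun.measurable_ancestor n).comap_le
  have hsub : history h ε ξ I J n ≤ selectionHistory h ε ξ I J n := le_sup_left
  have hx : Measurable[selectionHistory h ε ξ I J n] (ξ n) := (measurable_particle_history h ε le_rfl).mono hsub le_rfl
  have hw := (measurable_weight_history (ξ := ξ) (I := I) (J := J) h ε A ρ n).mono hsub le_rfl
  have ht := (measurable_stat_history (ξ := ξ) (I := I) (J := J) h ε n).mono hsub le_rfl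
  have hI : Measurable[selectionHistory h ε ξ I J n] (I (n + 1)) := measurable_iff_comap_le.2 le_sup_right
  refine (hrun.mutate n).measure_deviation_le hN hle' (hrun.measurable_particle (n + 1))
    (g := fun i ω y => (weightTerm A n (ρ n) (ξ n ω)
      (weight A ρ (fun k => ξ k ω) (fun k => I k ω) n) i (I (n + 1) ω i) y : ℝ) *
      statMean M h n (ε n) f g (ξ n ω) (weight A ρ (fun k => ξ k ω) (fun k => I k ω) n)
        (stat h ε (fun k => ξ k ω) (fun k => I k ω) (fun k => J k ω) n)
        (I (n + 1) ω i) y) (fun i => ?_) hC (fun i ω y => hbound ω i _ y) hδ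
  have hfst : Measurable[(selectionHistory h ε ξ I J n).prod inferInstance,
      selectionHistory h ε ξ I J n] (Prod.fst : Ω × X (n + 1) → Ω) := measurable_fst
  have hIi := ((measurable_pi_apply i).comp hI).comp hfst
  exact (measurable_weightTerm A (ρ n) i (hx.comp measurable_fst) (hw.comp measurable_fst)
    hIi measurable_snd).coe_nnreal_real.mul (measurable_statMean M h (ε n) hf hg
      (hx.comp measurable_fst) (hw.comp measurable_fst) (ht.comp measurable_fst) hIi
      measurable_snd)

theorem IsRun.measure_selection_deviation_le (hrun : IsRun P A h ρ ε ξ I J) (hN : 1 ≤ N)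
    (hf : Measurable f) (hg : Measurable g) (hC : 0 < C)
    (hbound : ∀ ω i l, |mutationMean A h n (ρ n) (ε n) f g (ξ n ω)
        (weight A ρ (fun k => ξ k ω) (fun k => I k ω) n)
        (stat h ε (fun k => ξ k ω) (fun k => I k ω) (fun k => J k ω) n) i l| ≤ C)
    (hδ : 0 < δ) :
    P {ω | δ ≤ |(N : ℝ)⁻¹ * ∑ i, (mutationMean A h n (ρ n) (ε n) f g (ξ n ω)
        (weight A ρ (fun k => ξ k ω) (fun k => I k ω) n)
        (stat h ε (fun k => ξ k ω) (fun k => I k ω) (fun k => J k ω) n)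
        i (I (n + 1) ω i) -
      selectionMean A h n (ρ n) (ε n) f g (ξ n ω)
        (weight A ρ (fun k => ξ k ω) (fun k => I k ω) n)
        (stat h ε (fun k => ξ k ω) (fun k => I k ω) (fun k => J k ω) n) i)|} ≤
      ENNReal.ofReal (2 * Real.exp (-(δ ^ 2 / (2 * C ^ 2)) * N)) := by
  have hle := history_le h ε n hrun.measurable_particle hrun.measurable_ancestor
    hrun.measurable_backward
  have := fun ω i => isProbabilityMeasure_ancestorLaw hN A n (ρ n) (ξ n ω)
    (weight A ρ (fun k => ξ k ω) (fun k => I k ω) n) i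
  exact (hrun.select n).measure_deviation_le hN hle (hrun.measurable_ancestor n)
    (g := fun i ω l => mutationMean A h n (ρ n) (ε n) f g (ξ n ω)
      (weight A ρ (fun k => ξ k ω) (fun k => I k ω) n)
      (stat h ε (fun k => ξ k ω) (fun k => I k ω) (fun k => J k ω) n) i l)
    (fun i => measurable_mutationMean A h (ρ n) (ε n) hf hg i
      (measurable_particle_history h ε le_rfl) (measurable_weight_history h ε A ρ n)
      (measurable_stat_history h ε n)) hC (fun i ω l => hbound ω i l) hδ

omit [IsProbabilityMeasure P] in
theorem IsRun.measure_init_deviation_le (hrun : IsRun P A h ρ ε ξ I J) (hN : 1 ≤ N)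
    {φ : X 0 → ℝ} (hφ : Measurable φ) (hC : 0 < C) (hφC : ∀ x, |φ x| ≤ C) (hδ : 0 < δ) :
    P {ω | δ ≤ |(N : ℝ)⁻¹ * ∑ i, (φ (ξ 0 ω i) - ∫ x, φ x ∂A.initLaw)|} ≤
      ENNReal.ofReal (2 * Real.exp (-(δ ^ 2 / (2 * C ^ 2)) * N)) := by
  refine le_of_eq_of_le ?_ (measure_pi_deviation_le hN (fun _ => A.initLaw) (fun _ => hφ) hC
    (fun _ => hφC) hδ)
  rw [← hrun.init, Measure.map_apply (hrun.measurable_particle 0)]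
  · rfl
  · refine measurableSet_le measurable_const (measurable_const.mul
      (Finset.measurable_sum _ fun i _ => ?_)).abs
    exact (hφ.comp (measurable_pi_apply i)).sub_const _

end Deviations

end AdaSmooth

/-! ### Almost sure convergence by induction on time. -/

namespace AdaSmooth

variable {X : ℕ → Type*} [∀ n, MeasurableSpace (X n)] {M : PathModel X}

section Consistency

variable {A : ApfParams M} {h : AdditiveTerms X} {ρ ε : ℕ → Bool} {Ω : Type*} [MeasurableSpace Ω]
  {P : Measure Ω} [IsProbabilityMeasure P] {ξ : ∀ (N : ℕ) (n : ℕ), Ω → Fin N → X n}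
  {I J : ∀ N : ℕ, ℕ → Ω → Fin N → Fin N}

/-- The weighted empirical mean of the particles at time `n` in the run with `N` particles. -/
noncomputable def runMean (A : ApfParams M) (h : AdditiveTerms X) (ρ ε : ℕ → Bool)
    (ξ : ∀ (N : ℕ) (n : ℕ), Ω → Fin N → X n) (I J : ∀ N : ℕ, ℕ → Ω → Fin N → Fin N)
    (n : ℕ) (f g : X n → ℝ) (N : ℕ) (ω : Ω) : ℝ :=
  empMean (ξ N n ω) (weight A ρ (fun k => ξ N k ω) (fun k => I N k ω) n)
    (stat h ε (fun k => ξ N k ω) (fun k => I N k ω) (fun k => J N k ω) n) f g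

theorem ae_tendsto_runMean_zero (hA : A.BoundedWeights)
    (hrun : ∀ N : ℕ, 1 ≤ N → IsRun P A h ρ ε (ξ N) (I N) (J N)) {f g : X 0 → ℝ}
    (hf : BoundedMeasurable f) (hg : BoundedMeasurable g) :
    ∀ᵐ ω ∂P, Tendsto (fun N => runMean A h ρ ε ξ I J 0 f g N ω) atTop (𝓝 (M.gamma h 0 f g)) := by
  let φ : X 0 → ℝ := fun x => (A.initWeight x : ℝ) * (h.init x * f x + g x)
  have hφ : BoundedMeasurable φ :=
    BoundedMeasurable.mul ⟨A.measurable_initWeight.coe_nnreal_real,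
      hA.1.elim fun C hC => ⟨C, fun x => by
        rw [abs_of_nonneg (NNReal.coe_nonneg _)]; exact_mod_cast hC x⟩⟩
      ((h.boundedMeasurable_init.mul hf).add hg)
  obtain ⟨C, hC, hφC⟩ := hφ.exists_pos_bound
  have hD := ae_tendsto_zero_of_measure_le (P := P) hC
    (D := fun N ω => (N : ℝ)⁻¹ * ∑ i, (φ (ξ N 0 ω i) - ∫ x, φ x ∂A.initLaw))
    fun N hN δ hδ => (hrun N hN).measure_init_deviation_le hN hφ.measurable hC hφC hδ
  have hmean : ∫ x, φ x ∂A.initLaw = M.gamma h 0 f g := by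
    rw [PathModel.gamma_zero]
    exact A.integral_initLaw _
  filter_upwards [hD] with ω hω
  rw [hmean] at hω
  have := hω.add_const (M.gamma h 0 f g)
  rw [zero_add] at this
  refine this.congr' ?_
  filter_upwards [eventually_ge_atTop 1] with N hN
  have hN0 : (N : ℝ) ≠ 0 := by exact_mod_cast (by omega : N ≠ 0)
  rw [Finset.sum_sub_distrib, mul_sub, Finset.sum_const, Finset.card_univ, Fintype.card_fin,
    nsmul_eq_mul, inv_mul_cancel_left₀ hN0, sub_add_cancel]
  rfl

/-- The weighted empirical mean after one more iteration is asymptotically equivalent to its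
conditional mean. -/
theorem ae_tendsto_runMean_succ_sub (hA : A.BoundedWeights)
    (hrun : ∀ N : ℕ, 1 ≤ N → IsRun P A h ρ ε (ξ N) (I N) (J N)) (n : ℕ) {f g : X (n + 1) → ℝ}
    (hf : BoundedMeasurable f) (hg : BoundedMeasurable g) :
    ∀ᵐ ω ∂P, Tendsto (fun N => runMean A h ρ ε ξ I J (n + 1) f g N ω -
      (N : ℝ)⁻¹ * ∑ i, selectionMean A h n (ρ n) (ε n) f g (ξ N n ω)
        (weight A ρ (fun k => ξ N k ω) (fun k => I N k ω) n)
        (stat h ε (fun k => ξ N k ω) (fun k => I N k ω) (fun k => J N k ω) n) i) atTop (𝓝 0) := by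
  obtain ⟨Cw, hCw⟩ := exists_weight_le hA ρ n
  obtain ⟨D, hD⟩ := hA.2.1 ρ n
  obtain ⟨Ct, hCt⟩ := exists_abs_stat_le h ε n
  obtain ⟨Ch, hCh⟩ := h.bounded_incr n
  obtain ⟨Cf, hCf⟩ := hf.bounded
  obtain ⟨Cg, hCg⟩ := hg.bounded
  set Cs := (Ct + Ch) * Cf + Cg with hCs
  -- One constant serves all three deviations, as averaging preserves bounds. The inner maximum
  -- covers both selection cases; the outer one makes `C` positive.
  let C : ℝ := max (((D * max 1 Cw : ℝ≥0) : ℝ) * Cs) 1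
  have hC : 0 < C := by positivity
  have hwt : ∀ N ω i l y, (weightTerm A n (ρ n) (ξ N n ω)
      (weight A ρ (fun k => ξ N k ω) (fun k => I N k ω) n) i l y : ℝ) ≤
      ((D * max 1 Cw : ℝ≥0) : ℝ) := by
    intro N ω i l y
    refine NNReal.coe_le_coe.2 (mul_le_mul (hD _ _) ?_ zero_le zero_le)
    split_ifs
    · exact le_max_left _ _
    · exact (hCw N _ _ i).trans (le_max_right _ _)
  have hprod : ∀ N ω i l y (s : ℝ), |s| ≤ Cs → |(weightTerm A n (ρ n) (ξ N n ω)
      (weight A ρ (fun k => ξ N k ω) (fun k => I N k ω) n) i l y : ℝ) * s| ≤ C := by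
    intro N ω i l y s hs
    rw [abs_mul, abs_of_nonneg (NNReal.coe_nonneg _)]
    exact (mul_le_mul (hwt N ω i l y) hs (abs_nonneg _) (NNReal.coe_nonneg _)).trans
      (le_max_left _ _)
  have hst : ∀ N ω l y j, |statTerm h n (ε n) f g (ξ N n ω)
      (stat h ε (fun k => ξ N k ω) (fun k => I N k ω) (fun k => J N k ω) n) l y j| ≤ Cs :=
    fun N ω l y j => abs_statTerm_le (hCt N _ _ _) hCh hCf hCg l y j
  have hsm : ∀ N, 1 ≤ N → ∀ ω l y, |statMean M h n (ε n) f g (ξ N n ω)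
      (weight A ρ (fun k => ξ N k ω) (fun k => I N k ω) n)
      (stat h ε (fun k => ξ N k ω) (fun k => I N k ω) (fun k => J N k ω) n) l y| ≤ Cs := by
    intro N hN ω l y
    have := isProbabilityMeasure_backwardLaw (M := M) hN n (ξ N n ω)
      (weight A ρ (fun k => ξ N k ω) (fun k => I N k ω) n) y
    exact abs_integral_le_of_abs_le _ (hst N ω l y)
  have h1 := ae_tendsto_zero_of_measure_le (P := P) hC fun N hN δ hδ =>
    (hrun N hN).measure_backward_deviation_le (n := n) hN hf.measurable hg.measurable hC
      (fun ω i l y j => hprod N ω i l y _ (hst N ω l y j)) hδ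
  have h2 := ae_tendsto_zero_of_measure_le (P := P) hC fun N hN δ hδ =>
    (hrun N hN).measure_mutation_deviation_le (n := n) hN hf.measurable hg.measurable hC
      (fun ω i l y => hprod N ω i l y _ (hsm N hN ω l y)) hδ
  have h3 := ae_tendsto_zero_of_measure_le (P := P) hC fun N hN δ hδ =>
    (hrun N hN).measure_selection_deviation_le (n := n) hN hf.measurable hg.measurable hC
      (fun ω i l => abs_integral_le_of_abs_le _
        fun y => hprod N ω i l y _ (hsm N hN ω l y)) hδ
  filter_upwards [h1, h2, h3] with ω hω1 hω2 hω3
  -- The three deviations telescope: from realized value to mean over `J`, then over the new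
  -- particles, then over the ancestors.
  have hsum := (hω1.add hω2).add hω3
  simp only [add_zero] at hsum
  refine hsum.congr fun N => ?_
  rw [← mul_add, ← mul_add, ← Finset.sum_add_distrib, ← Finset.sum_add_distrib, runMean, empMean,
    ← mul_sub, ← Finset.sum_sub_distrib]
  congr 1
  refine Finset.sum_congr rfl fun i _ => ?_
  rw [stat_succ_mul_add h ε (fun k => ξ N k ω), weight_succ]
  ring

/-- The weights are consistent only up to a normalization that each selection resets, hence the
factor `c`. It must precede the quantifiers on `f` and `g`, so that it cancels in ratios. The null
set may depend on the pair, since each step uses finitely many pairs. -/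
theorem exists_ae_tendsto_runMean (hA : A.BoundedWeights)
    (hρε : ∀ n, ρ n = false → ε n = false)
    (hrun : ∀ N : ℕ, 1 ≤ N → IsRun P A h ρ ε (ξ N) (I N) (J N)) (n : ℕ) :
    ∃ c : ℝ, 0 < c ∧ ∀ f g : X n → ℝ, BoundedMeasurable f → BoundedMeasurable g →
      ∀ᵐ ω ∂P, Tendsto (fun N => runMean A h ρ ε ξ I J n f g N ω) atTop
        (𝓝 (c * M.gamma h n f g)) := by
  induction n with
  | zero =>
    refine ⟨1, one_pos, fun f g hf hg => ?_⟩
    simpa only [one_mul] using ae_tendsto_runMean_zero hA hrun hf hg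
  | succ n ih =>
    obtain ⟨c, hc, ih⟩ := ih
    have hadj : BoundedMeasurable fun z => (A.adj n z : ℝ) :=
      ⟨(A.measurable_adj n).coe_nnreal_real, (hA.2.2 n).elim fun C hC => ⟨C, fun x => by
        rw [abs_of_nonneg (NNReal.coe_nonneg _)]; exact_mod_cast hC x⟩⟩
    have hpos := M.gamma_zero_pos h n hadj fun z => NNReal.coe_pos.2 (A.adj_pos n z)
    have htrans : ∀ f g : X (n + 1) → ℝ, BoundedMeasurable f → BoundedMeasurable g →
        ∀ᵐ ω ∂P, Tendsto (fun N => runMean A h ρ ε ξ I J n (M.trans n fun _ y => f y)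
          (M.trans n fun x y => h.incr n x y * f y + g y) N ω) atTop
          (𝓝 (c * M.gamma h (n + 1) f g)) := by
      intro f g hf hg
      rw [M.gamma_succ h n hf hg]
      exact ih _ _ (M.boundedMeasurable_trans n (hf.comp measurable_snd))
        (M.boundedMeasurable_trans n
          (((h.boundedMeasurable_incr n).mul (hf.comp measurable_snd)).add
            (hg.comp measurable_snd)))
    cases hr : ρ n with
    | false =>
      refine ⟨c, hc, fun f g hf hg => ?_⟩
      filter_upwards [ae_tendsto_runMean_succ_sub hA hrun n hf hg, htrans f g hf hg]
        with ω hω1 hω2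
      have hsum := hω1.add hω2
      rw [zero_add] at hsum
      refine hsum.congr' ?_
      filter_upwards [eventually_ge_atTop 1] with N hN
      rw [hr, hρε n hr, mean_selectionMean_false A h _ _ _ hN hf hg]
      exact sub_add_cancel _ _
    | true =>
      -- Numerator and denominator of the selection mean both carry the old `c`; it cancels, leaving
      -- the inverse limit of the multiplier mean.
      refine ⟨(M.gamma h n (fun _ => 0) fun z => (A.adj n z : ℝ))⁻¹, inv_pos.2 hpos,
        fun f g hf hg => ?_⟩
      filter_upwards [ae_tendsto_runMean_succ_sub hA hrun n hf hg, htrans f g hf hg,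
        ih _ _ (BoundedMeasurable.const 0) hadj] with ω hω1 hω2 hω3
      have hne := (mul_pos hc hpos).ne'
      have hsum := hω1.add (hω2.div hω3 hne)
      rw [zero_add, mul_div_mul_left _ _ hc.ne', div_eq_inv_mul (M.gamma h (n + 1) f g)] at hsum
      refine hsum.congr' ?_
      -- The multiplier mean has a nonzero limit, so for large `N` the degenerate uniform selection
      -- does not occur.
      filter_upwards [eventually_ge_atTop 1, hω3.eventually_ne hne] with N hN hN0
      rw [hr, mean_selectionMean_true A h _ _ _ hN (ε n) hf hg hN0]
      exact sub_add_cancel _ _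

end Consistency

theorem estimator_eq_div (A : ApfParams M) (h : AdditiveTerms X) (ρ ε : ℕ → Bool) {N : ℕ}
    (hN : 1 ≤ N) (ξ : ∀ n, Fin N → X n) (I J : ℕ → Fin N → Fin N) (n : ℕ) :
    estimator A h ρ ε ξ I J n =
      empMean (ξ n) (weight A ρ ξ I n) (stat h ε ξ I J n) (fun _ => 1) (fun _ => 0) /
        empMean (ξ n) (weight A ρ ξ I n) (stat h ε ξ I J n) (fun _ => 0) (fun _ => 1) := by
  have hN0 : (N : ℝ)⁻¹ ≠ 0 := inv_ne_zero (by exact_mod_cast (by omega : N ≠ 0))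
  simp only [estimator, empMean, mul_one, mul_zero, add_zero, zero_add]
  rw [mul_div_mul_left _ _ hN0, Finset.sum_div]
  exact Finset.sum_congr rfl fun i _ => by ring

end AdaSmooth

theorem theorem3p1 {X : ℕ → Type*} [∀ n, MeasurableSpace (X n)]
    (M : PathModel X) (A : ApfParams M) (hA : A.BoundedWeights)
    (ρ ε : ℕ → Bool) (hρε : ∀ n, ρ n = false → ε n = false)
    (h : AdditiveTerms X)
    {Ω : Type*} [MeasurableSpace Ω] (P : Measure Ω) [IsProbabilityMeasure P]
    (ξ : ∀ (N : ℕ) (n : ℕ), Ω → Fin N → X n)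
    (I J : ∀ N : ℕ, ℕ → Ω → Fin N → Fin N)
    (hrun : ∀ N : ℕ, 1 ≤ N → AdaSmooth.IsRun P A h ρ ε (ξ N) (I N) (J N))
    (n : ℕ) :
    ∀ᵐ ω ∂P, Tendsto
      (fun N : ℕ => AdaSmooth.estimator A h ρ ε
        (fun k => ξ N k ω) (fun k => I N k ω) (fun k => J N k ω) n)
      atTop (𝓝 (∫ x, h.functional n x ∂(M.post n))) := by
  obtain ⟨c, hc, hlim⟩ := AdaSmooth.exists_ae_tendsto_runMean hA hρε hrun n
  have hpos := M.gamma_zero_pos h n (BoundedMeasurable.const 1) fun _ => one_pos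
  filter_upwards [hlim _ _ (BoundedMeasurable.const 1) (BoundedMeasurable.const 0),
    hlim _ _ (BoundedMeasurable.const 0) (BoundedMeasurable.const 1)] with ω hω1 hω2
  have hdiv := hω1.div hω2 (mul_pos hc hpos).ne'
  rw [mul_div_mul_left _ _ hc.ne', ← M.integral_post h n] at hdiv
  refine hdiv.congr' ?_
  filter_upwards [eventually_ge_atTop 1] with N hN
  exact (AdaSmooth.estimator_eq_div A h ρ ε hN _ _ _ n).symm
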